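/- **Theorem 2.4 (Increasing FP potential implies low-degree hardness).** *Setting.* For every $n$ let $P_n$ be a probability measure on $\mathbb R^n$ (the prior), let $X,X'\sim P_n$ be independent, and consider the Gaussian additive model $Y=\sqrt{\lambda}\,X+Z$ with $Z\sim N(0,I_n)$ independent of $X$ and signal-to-noise ratio $\lambda>0$. Put $$\mathrm{Corr}^{\le D}_{P_n}(\lambda)^2=\sum_{i=1}^n\ \sup\Big\{\mathbb E[g(Y)X_i]^2:\ g\in\mathbb R[y_1,\dots,y_n],\ \deg g\le D,\ \mathbb E[g(Y)^2]=1\Big\},$$ $$q(D)=q_n(D)=\inf\{y\in\mathbb R:\ \mathbb P(|\langle X,X'\rangle|\le y)\ge 1-e^{-D}\}\qquad(D>0).$$ Let $(D_n)$, $(D_n')$ be sequences of positive integers, $(A_n)$ a sequence of positive reals and $C>0$ a constant, with $D_n\le n^C$, $D_n'=(1+o(1))D_n\log^2 n$ and $D_n'\ge D_n\log^2 n$ for all large $n$. Assume that for all large $n$ the overlap $\langle X,X'\rangle$ has a probability density $f_n$ which is positive and differentiable at $q(D_n)$. The annealed Franz–Parisi potential is $\mathcal F_{\mathrm{ann},\lambda}(q)=-\log\big(e^{\lambda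 q}f_n(q)\big)$, and $\mathcal F'_{\mathrm{ann},\lambda}$ denotes its derivative in $q$. Assume moreover that there are constants $\phi,K,C_1>0$, not depending on $n$, such that for all large $n$: 1. for every multi-index $\alpha\in\mathbb Z_{\ge0}^n$ with $1\le|\alpha|\le D_n$, the joint cumulant $\kappa_\alpha(X_1,\dots,X_n)$ (of $\alpha_i$ copies of $X_i$ for each $i$) is nonnegative; here the joint cumulant of $Y_1,\dots,Y_m$ is $\sum_\pi(-1)^{|\pi|-1}(|\pi|-1)!\prod_{B\in\pi}\mathbb E\big[\prod_{i\in B}Y_i\big]$, summed over the set partitions $\pi$ of $\{1,\dots,m\}$; 2. each marginal is sub-Weibull of order $\phi$: $(\mathbb E|X_i|^p)^{1/p}\le K p^{1/\phi}$ for all $i\le n$ and all real $p\ge1$; 3. $q(D_n\log^2 n)\ge\max\{(\log n)^{-D_n/2},\,n^{-C_1}\}$; 4. $\dfrac{d}{dt}\log f_n(t)\Big|_{t=q(D_n)}\ \ge\ -\dfrac{A_n}{q(D_n\log^2 n)\,\log n}$. *Conclusion.* There is $n_0$ such that for all $n\ge n_0$ and every $u>0$ with $u+\mathcal F'_{\mathrm{ann},u}(q(D_n))>0$,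 $$\mathrm{Corr}^{\le D_n}_{P_n}\Big(\tfrac1{A_n}\big(u+\mathcal F'_{\mathrm{ann},u}(q(D_n))\big)\Big)^2\ \le\ 2\,q(D_n').$$ In particular, for any sequence $\lambda=\lambda_n>0$ and all sufficiently large $n$, $\mathcal F'_{\mathrm{ann},\lambda}(q(D_n))\ge0$ implies $\mathrm{Corr}^{\le D_n}_{P_n}(\lambda/A_n)^2\le 2\,q(D_n')$. -/

import Mathlib

noncomputable section

namespace GaussianAdditive

open MeasureTheory ProbabilityTheory

/-- The law of the overlap `⟨X, X'⟩` of two independent draws `X, X'` from the prior `P`. -/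
def overlapLaw {n : ℕ} (P : Measure (Fin n → ℝ)) : Measure ℝ :=
  (P.prod P).map fun x => ∑ i, x.1 i * x.2 i

/-- The quantile `q(D) = inf {y : ℙ(|⟨X, X'⟩| ≤ y) ≥ 1 - e^{-D}}` of the absolute overlap. -/
def overlapQuantile {n : ℕ} (P : Measure (Fin n → ℝ)) (D : ℝ) : ℝ :=
  sInf {y : ℝ | 1 - Real.exp (-D) ≤ (overlapLaw P).real {s | |s| ≤ y}}

/-- `f` is a version of the probability density function of the overlap `⟨X, X'⟩`. -/
structure IsOverlapPDF {n : ℕ} (P : Measure (Fin n → ℝ)) (f : ℝ → ℝ) : Prop where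
  measurable : Measurable f
  nonneg : ∀ t, 0 ≤ f t
  law_eq : overlapLaw P = volume.withDensity fun t => ENNReal.ofReal (f t)

/-- The annealed Franz-Parisi potential `-log 𝔼[1_{⟨X, X'⟩ = q} exp (lam * ⟨X, X'⟩)]`, where the
expectation over the event `⟨X, X'⟩ = q` is read as a density, `f` being the PDF of the overlap. -/
def annealedFP (f : ℝ → ℝ) (lam q : ℝ) : ℝ :=
  -Real.log (Real.exp (lam * q) * f q)

/-- The joint cumulant `κ(Y_i : i ∈ ι)` of a finite family of random variables having moments of
all orders: the sum over the set partitions `π` of `ι` of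
`(-1)^(|π| - 1) * (|π| - 1)! * ∏_{B ∈ π} 𝔼[∏_{i ∈ B} Y_i]`. Only nonempty `ι` matter. -/
def jointCumulant {Ω ι : Type*} [MeasurableSpace Ω] [Fintype ι] [DecidableEq ι]
    (μ : Measure Ω) (Y : ι → Ω → ℝ) : ℝ :=
  ∑ π : Finpartition (Finset.univ : Finset ι),
    (-1) ^ (π.parts.card - 1) * ((π.parts.card - 1).factorial : ℝ) *
      ∏ B ∈ π.parts, ∫ ω, ∏ i ∈ B, Y i ω ∂μ

/-- `κ_α(X_1, …, X_n)` for `X ∼ P`: the joint cumulant of the family that contains `α i` copies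
of the coordinate `X_i`, for every `i`. -/
def cumulant {n : ℕ} (P : Measure (Fin n → ℝ)) (α : Fin n → ℕ) : ℝ :=
  jointCumulant P fun (s : Σ i : Fin n, Fin (α i)) (x : Fin n → ℝ) => x s.1

/-- `X` is sub-Weibull of order `φ` with constant `K`: `(𝔼 |X|^p)^(1/p) ≤ K * p^(1/φ)` for all
real `p ≥ 1`. -/
def IsSubWeibull {Ω : Type*} [MeasurableSpace Ω] (φ K : ℝ) (X : Ω → ℝ) (μ : Measure Ω) : Prop :=
  ∀ p : ℝ, 1 ≤ p → eLpNorm X (ENNReal.ofReal p) μ ≤ ENNReal.ofReal (K * p ^ (1 / φ))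

/-- The joint law of the signal `X ∼ P` and an independent noise vector `Z ∼ N(0, I_n)`. -/
def signalNoiseLaw {n : ℕ} (P : Measure (Fin n → ℝ)) :
    Measure ((Fin n → ℝ) × (Fin n → ℝ)) :=
  P.prod (Measure.pi fun _ => gaussianReal 0 1)

/-- The observation `Y = √lam * X + Z` at signal-to-noise ratio `lam`, as a function of `(X, Z)`. -/
def observation {n : ℕ} (lam : ℝ) (ω : (Fin n → ℝ) × (Fin n → ℝ)) : Fin n → ℝ :=
  fun j => √lam * ω.1 j + ω.2 j

/-- The degree-`D` correlation
`√(∑_i sup {𝔼[g(Y) X_i]² : g a polynomial of degree at most D with 𝔼[g(Y)²] = 1})`. -/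
def lowDegreeCorr {n : ℕ} (P : Measure (Fin n → ℝ)) (D : ℕ) (lam : ℝ) : ℝ :=
  √(∑ i : Fin n, sSup {c : ℝ | ∃ g : MvPolynomial (Fin n) ℝ, g.totalDegree ≤ D ∧
    ∫ ω, (MvPolynomial.eval (observation lam ω) g) ^ 2 ∂(signalNoiseLaw P) = 1 ∧
    c = (∫ ω, MvPolynomial.eval (observation lam ω) g * ω.1 i ∂(signalNoiseLaw P)) ^ 2})

/-- The overlap has a density `f n` which, for `n` large, is positive and differentiable at the
quantile `q(D n)`, so that the logarithmic derivatives below make sense. -/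
def HasRegularOverlapPDF (P : ∀ n : ℕ, Measure (Fin n → ℝ)) (f : ℕ → ℝ → ℝ) (D : ℕ → ℕ) : Prop :=
  ∀ᶠ n : ℕ in Filter.atTop, IsOverlapPDF (P n) (f n) ∧
    0 < f n (overlapQuantile (P n) (D n)) ∧
    DifferentiableAt ℝ (f n) (overlapQuantile (P n) (D n))

/-- Low-order cumulant-nonnegative Gaussian additive models, with parameters `D`, `A` and `C`.
`P n` is the prior on `ℝ^n` and `f n` the PDF of the overlap. The conditions are asymptotic: they
are imposed for all large `n`, with `C`, `φ`, `K`, `C₁` not depending on `n`. -/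
structure IsLowOrderCumulantNonneg (P : ∀ n : ℕ, Measure (Fin n → ℝ)) (f : ℕ → ℝ → ℝ)
    (D : ℕ → ℕ) (A : ℕ → ℝ) (C : ℝ) : Prop where
  C_pos : 0 < C
  D_pos : ∀ n, 0 < D n
  D_le : ∀ᶠ n : ℕ in Filter.atTop, (D n : ℝ) ≤ (n : ℝ) ^ C
  A_pos : ∀ n, 0 < A n
  /-- nonnegative joint cumulants of order at most `D n` -/
  cumulant_nonneg : ∀ᶠ n : ℕ in Filter.atTop, ∀ α : Fin n → ℕ, 1 ≤ ∑ i, α i → ∑ i, α i ≤ D n →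
    0 ≤ cumulant (P n) α
  /-- sub-Weibull marginals -/
  subWeibull : ∃ φ : ℝ, 0 < φ ∧ ∃ K : ℝ, 0 < K ∧ ∀ᶠ n : ℕ in Filter.atTop, ∀ i : Fin n,
    IsSubWeibull φ K (fun x : Fin n → ℝ => x i) (P n)
  /-- controlled decay of the overlap quantiles -/
  quantile_decay : ∃ C₁ : ℝ, 0 < C₁ ∧ ∀ᶠ n : ℕ in Filter.atTop,
    max (Real.log n ^ (-(D n : ℝ) / 2)) ((n : ℝ) ^ (-C₁)) ≤
      overlapQuantile (P n) (D n * Real.log n ^ 2)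
  /-- quantile stability -/
  quantile_stability : ∀ᶠ n : ℕ in Filter.atTop,
    -(A n / (overlapQuantile (P n) (D n * Real.log n ^ 2) * Real.log n)) ≤
      deriv (fun t => Real.log (f n t)) (overlapQuantile (P n) (D n))

end GaussianAdditive

end

/-! The correlation is bounded by duality. Suppose `W_i(Z)` depends on the noise alone and `𝔼[W_i(Z)
g(Y)] = 𝔼[X_i g(Y)]` for all `g` of degree at most `D`. Cauchy–Schwarz then gives `𝔼[g(Y) X_i]² ≤
𝔼[W_i²]` whenever `𝔼[g(Y)²] = 1`. Written in the Hermite basis of `Z` and tested on `He_α(Y)`, the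
requirement on `W_i` is a triangular linear system, and this system is the moment-cumulant recursion
(`multiMoment_add_single`). Its solution has coefficients `√λ^|β| κ_{β+e_i} / β!`
(`integral_certificate_mul_hermiteProd`), so `Corr²` is at most the sum over `i` and `|β| ≤ D` of
`λ^|β| κ_{β+e_i}² / β!` (`lowDegreeCorr_sq_le`).

When the cumulants are nonnegative, so is every term of the recursion, hence `0 ≤ κ ≤` moment up to
order `D`. The squared moments, weighted by `1/β!`, add up to moments of the overlap. Cumulants of
order `D + 1` also occur and carry no sign; the recursion expresses them through lower orders, at a
cost exponential in `D` (`cumulant_sq_le`).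

Let `q = q(D log² n)`. The overlap exceeds `q` in absolute value with probability at most `exp(-D
log² n)`, which beats the growth `n^{O(D)}` that sub-Weibull tails allow. The overlap moments of
order `k ≤ D + 1` are therefore at most `5/4 q^k` in absolute value
(`abs_overlapMoment_le_of_isSubWeibull`). The bound on `Corr²` becomes a geometric series in `λ q`,
which is at most `2 q` once `λ ≤ 1 / (q log n)` and `n` is large.

The potential enters only at the end: `F'_u = -u - (log f)'`, so `u + F'_u` does not depend on `u`,
and quantile stability bounds it by `A / (q log n)`. -/

namespace GaussianAdditive

open MeasureTheory ProbabilityTheory Polynomial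

/-! ### Closure properties of functions with all moments. -/

/-- `f` lies in every `L^p` with `p` finite. -/
def HasAllMoments {Ω : Type*} [MeasurableSpace Ω] (f : Ω → ℝ) (μ : Measure Ω) : Prop :=
  ∀ p : ℕ, MemLp f p μ

namespace HasAllMoments

variable {Ω Ω' : Type*} [MeasurableSpace Ω] [MeasurableSpace Ω'] {μ : Measure Ω}
  {ν : Measure Ω'} {f g : Ω → ℝ}

lemma const [IsFiniteMeasure μ] (c : ℝ) : HasAllMoments (fun _ : Ω => c) μ :=
  fun _ => memLp_const c

lemma add (hf : HasAllMoments f μ) (hg : HasAllMoments g μ) :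
    HasAllMoments (fun x => f x + g x) μ := fun p => (hf p).add (hg p)

lemma mul (hf : HasAllMoments f μ) (hg : HasAllMoments g μ) :
    HasAllMoments (fun x => f x * g x) μ := fun p => by
  -- Hölder with exponents `2p, 2p, p`, so that membership for all natural exponents is preserved by
  -- products; `p = 0` is included.
  have h : ENNReal.HolderTriple ((2 * p : ℕ) : ENNReal) ((2 * p : ℕ) : ENNReal) (p : ENNReal) := by
    constructor
    rcases Nat.eq_zero_or_pos p with rfl | hp
    · simp
    · push_cast
      rw [ENNReal.mul_inv (by simp) (by simp), ← add_mul, ENNReal.inv_two_add_inv_two, one_mul]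
  exact (hg (2 * p)).mul (hf (2 * p)) (hpqr := h)

lemma const_mul (hf : HasAllMoments f μ) (c : ℝ) : HasAllMoments (fun x => c * f x) μ :=
  fun p => (hf p).const_mul c

lemma pow [IsFiniteMeasure μ] (hf : HasAllMoments f μ) (k : ℕ) :
    HasAllMoments (fun x => f x ^ k) μ := by
  induction k with
  | zero => simpa using const 1
  | succ k ih => simpa only [pow_succ] using ih.mul hf

lemma prod [IsFiniteMeasure μ] {ι : Type*} {s : Finset ι} {F : ι → Ω → ℝ}
    (hF : ∀ i ∈ s, HasAllMoments (F i) μ) : HasAllMoments (fun x => ∏ i ∈ s, F i x) μ := by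
  classical
  induction s using Finset.induction_on with
  | empty => simpa using const 1
  | insert a s ha ih =>
    simp only [Finset.prod_insert ha]
    exact (hF a (by simp)).mul (ih fun i hi => hF i (by simp [hi]))

lemma sum [IsFiniteMeasure μ] {ι : Type*} {s : Finset ι} {F : ι → Ω → ℝ}
    (hF : ∀ i ∈ s, HasAllMoments (F i) μ) : HasAllMoments (fun x => ∑ i ∈ s, F i x) μ :=
  fun p => memLp_finsetSum s fun i hi => hF i hi p

lemma polynomial [IsFiniteMeasure μ] (hf : HasAllMoments f μ) (p : ℝ[X]) :
    HasAllMoments (fun x => p.eval (f x)) μ := by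
  simp only [eval_eq_sum_range]
  exact sum fun i _ => (hf.pow i).const_mul _

lemma mvPolynomial [IsFiniteMeasure μ] {ι : Type*} {F : Ω → ι → ℝ}
    (hF : ∀ i, HasAllMoments (fun x => F x i) μ) (p : MvPolynomial ι ℝ) :
    HasAllMoments (fun x => MvPolynomial.eval (F x) p) μ := by
  simp only [MvPolynomial.eval_eq]
  exact sum fun i _ => (prod fun j _ => (hF j).pow _).const_mul _

lemma integrable (hf : HasAllMoments f μ) : Integrable f μ :=
  memLp_one_iff_integrable.mp (by simpa using hf 1)

lemma comp (hf : HasAllMoments f μ) {φ : Ω' → Ω} (hφ : MeasurePreserving φ ν μ) :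
    HasAllMoments (fun x => f (φ x)) ν := fun p => (hf p).comp_measurePreserving hφ

end HasAllMoments

/-! ### Hermite polynomials under the Gaussian measure. -/

lemma hasAllMoments_gaussianReal : HasAllMoments (fun x : ℝ => x) (gaussianReal 0 1) :=
  fun p => memLp_id_gaussianReal' (μ := 0) (v := 1) (p : ENNReal) (by simp)

lemma hasDerivAt_gaussianPDFReal (x : ℝ) :
    HasDerivAt (gaussianPDFReal 0 1) (-x * gaussianPDFReal 0 1 x) x := by
  have h : gaussianPDFReal 0 1 =
      fun x : ℝ => (√(2 * Real.pi))⁻¹ * Real.exp (-x ^ 2 / 2) := by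
    ext y; simp [gaussianPDFReal]
  rw [h]
  have h1 : HasDerivAt (fun x : ℝ => -x ^ 2 / 2) (-x) x := by
    refine (((hasDerivAt_pow 2 x).neg).div_const 2).congr_deriv ?_
    simp [neg_div]
  refine (h1.exp.const_mul (√(2 * Real.pi))⁻¹).congr_deriv ?_
  ring

lemma integrable_gaussianPDFReal_mul_eval (p : ℝ[X]) :
    Integrable fun x : ℝ => gaussianPDFReal 0 1 x * p.eval x := by
  have h := (hasAllMoments_gaussianReal.polynomial p).integrable
  rw [gaussianReal_of_var_ne_zero _ one_ne_zero,
    integrable_withDensity_iff_integrable_smul' (measurable_gaussianPDF _ _)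
      (Filter.Eventually.of_forall fun _ => gaussianPDF_lt_top)] at h
  simpa using h

/-- Gaussian integration by parts for polynomials. -/
lemma integral_id_mul_eval_gaussianReal (p : ℝ[X]) :
    ∫ x, x * p.eval x ∂gaussianReal 0 1 = ∫ x, p.derivative.eval x ∂gaussianReal 0 1 := by
  rw [integral_gaussianReal_eq_integral_smul one_ne_zero,
    integral_gaussianReal_eq_integral_smul one_ne_zero, eq_comm, ← sub_eq_zero]
  have hX := integrable_gaussianPDFReal_mul_eval (X * p)
  have hd := integrable_gaussianPDFReal_mul_eval (derivative p)
  simp only [eval_mul, eval_X] at hX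
  simp only [smul_eq_mul]
  rw [← integral_sub hd hX]
  -- The difference of the two integrands is the derivative of density times `p`, which is
  -- integrable on the line.
  refine integral_eq_zero_of_hasDerivAt_of_integrable
    (f := fun x => gaussianPDFReal 0 1 x * p.eval x) (fun x => ?_) (hd.sub hX)
    (integrable_gaussianPDFReal_mul_eval p)
  refine ((hasDerivAt_gaussianPDFReal x).mul (p.hasDerivAt x)).congr_deriv ?_
  ring

/-- The probabilists' Hermite polynomials with real coefficients. -/
noncomputable def hermiteReal (k : ℕ) : ℝ[X] := (hermite k).map (Int.castRingHom ℝ)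

@[simp] lemma hermiteReal_zero : hermiteReal 0 = 1 := by simp [hermiteReal]

lemma hermiteReal_succ (k : ℕ) :
    hermiteReal (k + 1) = X * hermiteReal k - derivative (hermiteReal k) := by
  simp [hermiteReal, hermite_succ, derivative_map]

lemma derivative_hermiteReal_succ (k : ℕ) :
    derivative (hermiteReal (k + 1)) = C ((k : ℝ) + 1) * hermiteReal k := by
  induction k with
  | zero => simp [hermiteReal_succ]
  | succ k ih =>
    rw [hermiteReal_succ (k + 1), derivative_sub, derivative_mul, ih, derivative_mul,
      hermiteReal_succ k]
    simp
    ring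

lemma integral_hermiteReal_succ_mul (b : ℕ) (p : ℝ[X]) :
    ∫ x, (hermiteReal (b + 1)).eval x * p.eval x ∂gaussianReal 0 1 =
      ∫ x, (hermiteReal b).eval x * p.derivative.eval x ∂gaussianReal 0 1 := by
  have hint (q : ℝ[X]) := (hasAllMoments_gaussianReal.polynomial q).integrable
  have h := integral_id_mul_eval_gaussianReal (hermiteReal b * p)
  have e : (fun x => (hermiteReal (b + 1)).eval x * p.eval x) = fun x =>
      (X * (hermiteReal b * p)).eval x - (derivative (hermiteReal b) * p).eval x := by
    ext x; simp [hermiteReal_succ]; ring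
  rw [e, integral_sub (hint _) (hint _)]
  simp only [eval_mul, eval_X] at h ⊢
  rw [h, ← integral_sub (hint _) (by simpa using hint (derivative (hermiteReal b) * p))]
  simp

lemma integral_hermiteReal_mul (b : ℕ) (p : ℝ[X]) :
    ∫ x, (hermiteReal b).eval x * p.eval x ∂gaussianReal 0 1 =
      ∫ x, (derivative^[b] p).eval x ∂gaussianReal 0 1 := by
  induction b generalizing p with
  | zero => simp
  | succ b ih => rw [integral_hermiteReal_succ_mul, ih, Function.iterate_succ_apply]

lemma iterate_derivative_hermiteReal (a b : ℕ) :
    derivative^[b] (hermiteReal a) = C (a.descFactorial b : ℝ) * hermiteReal (a - b) := by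
  induction b generalizing a with
  | zero => simp
  | succ b ih =>
    cases a with
    | zero => simp
    | succ a =>
      rw [Function.iterate_succ_apply, derivative_hermiteReal_succ,
        iterate_derivative_C_mul, ih, Nat.succ_descFactorial_succ]
      simp [mul_assoc]

lemma iterate_derivative_comp_C_add_X (t : ℝ) (p : ℝ[X]) (b : ℕ) :
    derivative^[b] (p.comp (C t + X)) = (derivative^[b] p).comp (C t + X) := by
  induction b generalizing p with
  | zero => rfl
  | succ b ih => simp [derivative_comp, ih]

/-- In the recursion for `He_{c+1}(t + x)` the part `x q - q'` integrates to zero by parts, so each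
degree contributes one factor `t`. -/
lemma integral_hermiteReal_comp (c : ℕ) (t : ℝ) :
    ∫ x, (hermiteReal c).eval (t + x) ∂gaussianReal 0 1 = t ^ c := by
  induction c with
  | zero => simp
  | succ c ih =>
    have hint (q : ℝ[X]) := (hasAllMoments_gaussianReal.polynomial q).integrable
    set q := (hermiteReal c).comp (C t + X) with hq
    have e : (fun x => (hermiteReal (c + 1)).eval (t + x)) = fun x =>
        t * q.eval x + ((X * q).eval x - (derivative q).eval x) := by
      ext x; simp [hermiteReal_succ, hq, derivative_comp]; ring
    have hs : Integrable (fun x => (X * q).eval x - (derivative q).eval x) (gaussianReal 0 1) :=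
      (hint _).sub (hint _)
    rw [e, integral_add ((hint _).const_mul _) hs, integral_sub (hint _) (hint _)]
    have h := integral_id_mul_eval_gaussianReal q
    simp only [eval_mul, eval_X, h, integral_const_mul, sub_self, add_zero]
    simp only [hq, eval_comp, eval_add, eval_C, eval_X, ih, pow_succ']

/-- The translated orthogonality relation of the Hermite polynomials. -/
lemma integral_hermiteReal_mul_hermiteReal_comp (a b : ℕ) (t : ℝ) :
    ∫ x, (hermiteReal b).eval x * (hermiteReal a).eval (t + x) ∂gaussianReal 0 1 =
      a.descFactorial b * t ^ (a - b) := by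
  have h := integral_hermiteReal_mul b ((hermiteReal a).comp (C t + X))
  rw [iterate_derivative_comp_C_add_X, iterate_derivative_hermiteReal] at h
  simpa [integral_const_mul, integral_hermiteReal_comp] using h

/-- Powers are combinations of Hermite polynomials of at most the same degree. -/
lemma exists_pow_eq_sum_hermiteReal :
    ∃ c : ℕ → ℕ → ℝ, ∀ (k : ℕ) (x : ℝ),
      x ^ k = ∑ a ∈ Finset.range (k + 1), c k a * (hermiteReal a).eval x := by
  suffices h : ∀ k : ℕ, ∃ c : ℕ → ℝ, ∀ x : ℝ,
      x ^ k = ∑ a ∈ Finset.range (k + 1), c a * (hermiteReal a).eval x by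
    choose c hc using h
    exact ⟨c, hc⟩
  intro k
  have key : ∀ p : ℝ[X], p.natDegree ≤ k → ∃ c : ℕ → ℝ, ∀ x : ℝ,
      p.eval x = ∑ a ∈ Finset.range (k + 1), c a * (hermiteReal a).eval x := by
    have hdeg (j : ℕ) : (hermiteReal j).natDegree = j ∧ (hermiteReal j).Monic :=
      ⟨by rw [hermiteReal, (hermite_monic j).natDegree_map, natDegree_hermite],
        (hermite_monic j).map _⟩
    induction k with
    | zero =>
      intro p hp
      rw [eq_C_of_natDegree_le_zero hp]
      exact ⟨fun _ => p.coeff 0, fun x => by simp⟩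
    | succ k ih =>
      intro p hp
      -- Hermite polynomials are monic, so subtracting the leading coefficient times `He_{k+1}`
      -- lowers the degree.
      have hd : (p - C (p.coeff (k + 1)) * hermiteReal (k + 1)).natDegree ≤ k := by
        rw [natDegree_le_iff_coeff_eq_zero]
        intro N hN
        rcases eq_or_lt_of_le (Nat.succ_le_of_lt hN) with h | h
        · have h1 := (hdeg (k + 1)).2.coeff_natDegree
          rw [(hdeg (k + 1)).1] at h1
          subst h
          simp [h1]
        · rw [coeff_sub, coeff_C_mul, coeff_eq_zero_of_natDegree_lt (lt_of_le_of_lt hp h),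
            coeff_eq_zero_of_natDegree_lt (p := hermiteReal (k + 1))
              (by rw [(hdeg (k + 1)).1]; exact h)]
          simp
      obtain ⟨c, hc⟩ := ih _ hd
      refine ⟨fun a => if a = k + 1 then p.coeff (k + 1) else c a, fun x => ?_⟩
      have h1 : ∑ a ∈ Finset.range (k + 1), (if a = k + 1 then p.coeff (k + 1) else c a) *
          (hermiteReal a).eval x = (p - C (p.coeff (k + 1)) * hermiteReal (k + 1)).eval x := by
        rw [hc x]
        exact Finset.sum_congr rfl fun a ha => by rw [if_neg (Finset.mem_range.mp ha).ne]
      rw [Finset.sum_range_succ, h1]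
      simp
  obtain ⟨c, hc⟩ := key (X ^ k) (natDegree_X_pow_le k)
  exact ⟨c, fun x => by simpa using hc x⟩

end GaussianAdditive

namespace GaussianAdditive

open MeasureTheory ProbabilityTheory

/-! ### Set partitions and the moment-cumulant recursion. -/

section SetPartitions

variable {ι ι' : Type*} [Fintype ι] [Fintype ι'] [DecidableEq ι] [DecidableEq ι']

open scoped Classical in
/-- The set partitions of `S`, as sets of nonempty blocks. -/
noncomputable def setPartitions (S : Finset ι) : Finset (Finset (Finset ι)) :=
  Finset.univ.filter fun Q => (Q : Set (Finset ι)).PairwiseDisjoint id ∧ Q.sup id = S ∧ ∅ ∉ Q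

lemma mem_setPartitions {S : Finset ι} {Q : Finset (Finset ι)} :
    Q ∈ setPartitions S ↔
      (Q : Set (Finset ι)).PairwiseDisjoint id ∧ Q.sup id = S ∧ ∅ ∉ Q := by
  simp [setPartitions]

/-- The cumulant of the block `S` associated with the moments `m`. -/
noncomputable def setCumulant (m : Finset ι → ℝ) (S : Finset ι) : ℝ :=
  ∑ Q ∈ setPartitions S, (-1) ^ (Q.card - 1) * ((Q.card - 1).factorial : ℝ) * ∏ B ∈ Q, m B

/-- The type `Finpartition S` depends on `S`; plain families of blocks let a block be inserted or
erased without leaving the type. -/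
lemma jointCumulant_eq_setCumulant {Ω : Type*} [MeasurableSpace Ω] (μ : Measure Ω)
    (Y : ι → Ω → ℝ) :
    jointCumulant μ Y = setCumulant (fun B => ∫ ω, ∏ i ∈ B, Y i ω ∂μ) Finset.univ := by
  unfold jointCumulant setCumulant
  refine Finset.sum_bij (fun π _ => π.parts) (fun π _ => ?_) (fun π _ π' _ h => ?_)
    (fun Q hQ => ?_) (fun π _ => rfl)
  · rw [mem_setPartitions]
    exact ⟨π.disjoint, π.sup_parts, π.bot_notMem⟩
  · exact Finpartition.ext h
  · rw [mem_setPartitions] at hQ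
    exact ⟨⟨Q, Finset.supIndep_iff_pairwiseDisjoint.mpr hQ.1, hQ.2.1, hQ.2.2⟩,
      Finset.mem_univ _, rfl⟩

/-- Partitions of an image under an embedding are exactly the images of partitions. This moves
cumulants between index types. -/
lemma setCumulant_map (φ : ι' ↪ ι) (m : Finset ι → ℝ) (S : Finset ι') :
    setCumulant (fun B => m (B.map φ)) S = setCumulant m (S.map φ) := by
  unfold setCumulant
  have hsup (Q : Finset (Finset ι')) :
      (Q.map (Finset.mapEmbedding φ).toEmbedding).sup id = (Q.sup id).map φ := by
    ext y
    simp only [Finset.mem_sup, Finset.mem_map]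
    constructor
    · rintro ⟨_, ⟨B, hB, rfl⟩, hy⟩
      obtain ⟨x, hx, rfl⟩ := Finset.mem_map.mp hy
      exact ⟨x, ⟨B, hB, hx⟩, rfl⟩
    · rintro ⟨x, ⟨B, hB, hx⟩, rfl⟩
      exact ⟨_, ⟨B, hB, rfl⟩, Finset.mem_map_of_mem φ hx⟩
  have hmem (Q : Finset (Finset ι')) :
      Q.map (Finset.mapEmbedding φ).toEmbedding ∈ setPartitions (S.map φ) ↔
        Q ∈ setPartitions S := by
    rw [mem_setPartitions, mem_setPartitions, hsup, Finset.map_inj]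
    refine and_congr ?_ (and_congr Iff.rfl ?_)
    · constructor
      · intro h A hA B hB hAB
        have := h (Finset.mem_coe.mpr (Finset.mem_map_of_mem _ hA))
          (Finset.mem_coe.mpr (Finset.mem_map_of_mem _ hB)) (by simpa using hAB)
        exact Finset.disjoint_map φ |>.mp this
      · intro h A hA B hB hAB
        simp only [Finset.coe_map, Set.mem_image] at hA hB
        obtain ⟨A, hA, rfl⟩ := hA
        obtain ⟨B, hB, rfl⟩ := hB
        have := h hA hB (by rintro rfl; exact hAB rfl)
        exact Finset.disjoint_map φ |>.mpr this
    · simp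
  refine Finset.sum_bij (fun Q _ => Q.map (Finset.mapEmbedding φ).toEmbedding)
    (fun Q hQ => (hmem Q).mpr hQ) (fun Q _ Q' _ h => Finset.map_injective _ h) (fun R hR => ?_)
    (fun Q _ => by simp)
  have hR' := mem_setPartitions.mp hR
  have hRange : ∀ B ∈ R, ∃ A : Finset ι', A.map φ = B := fun B hB => by
    have hB' : B ⊆ S.map φ := hR'.2.1 ▸ Finset.le_sup (f := id) hB
    obtain ⟨A, -, hA⟩ := Finset.subset_map_iff.mp hB'
    exact ⟨A, hA.symm⟩
  have hex : (Finset.univ.filter fun A : Finset ι' => A.map φ ∈ R).map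
      (Finset.mapEmbedding φ).toEmbedding = R := by
    ext B
    simp only [Finset.mem_map, Finset.mem_filter, Finset.mem_univ, true_and]
    constructor
    · rintro ⟨A, hA, rfl⟩; exact hA
    · intro hB
      obtain ⟨A, rfl⟩ := hRange B hB
      exact ⟨A, hB, rfl⟩
  exact ⟨_, (hmem _).mp (hex.symm ▸ hR), hex⟩

lemma exists_mem_of_mem_setPartitions {S : Finset ι} {Q : Finset (Finset ι)}
    (hQ : Q ∈ setPartitions S) {x : ι} (hx : x ∈ S) :
    ∃ B ∈ Q, x ∈ B ∧ Q.filter (fun B => x ∉ B) = Q.erase B := by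
  obtain ⟨hd, hs, -⟩ := mem_setPartitions.mp hQ
  rw [← hs, Finset.mem_sup] at hx
  obtain ⟨B, hB, hxB⟩ := hx
  refine ⟨B, hB, hxB, ?_⟩
  ext A
  simp only [Finset.mem_filter, Finset.mem_erase]
  constructor
  · rintro ⟨hA, hxA⟩
    exact ⟨by rintro rfl; exact hxA hxB, hA⟩
  · rintro ⟨hAB, hA⟩
    exact ⟨hA, fun hxA => Finset.disjoint_left.mp (hd hA hB hAB) hxA hxB⟩

/-- The moment-cumulant recursion over the block that contains a distinguished element. -/
lemma eq_sum_setCumulant_mul (m : Finset ι → ℝ) (h0 : m ∅ = 1) {S : Finset ι} {x : ι}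
    (hx : x ∈ S) :
    m S = ∑ T ∈ S.powerset.filter (fun T => x ∈ T), setCumulant m T * m (S \ T) := by
  set c : ℕ → ℝ := fun k => (-1) ^ (k - 1) * ((k - 1).factorial : ℝ) with hc
  have hS : S ∈ S.powerset.filter (fun T => x ∈ T) := by simp [hx]
  rw [← Finset.add_sum_erase _ _ hS, Finset.sdiff_self, h0, mul_one]
  -- A proper `T` with a partition of `T` is the same as a partition of `S` with a marked block `S \
  -- T` that misses `x`.
  have hproper : ∑ T ∈ (S.powerset.filter (fun T => x ∈ T)).erase S,
      setCumulant m T * m (S \ T) =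
      ∑ Q ∈ setPartitions S, ∑ B ∈ Q.filter (fun B => x ∉ B),
        c (Q.card - 1) * ∏ B ∈ Q, m B := by
    unfold setCumulant
    simp only [Finset.sum_mul]
    rw [Finset.sum_sigma', Finset.sum_sigma']
    have key : ∀ T ∈ (S.powerset.filter (fun T => x ∈ T)).erase S, ∀ Q ∈ setPartitions T,
        S \ T ∉ Q := fun T hT Q hQ hmem => by
      simp only [Finset.mem_erase, Finset.mem_filter, Finset.mem_powerset] at hT
      obtain ⟨hd, hs, hne⟩ := mem_setPartitions.mp hQ
      have h1 : S \ T ⊆ T := (Finset.le_sup (f := id) hmem).trans hs.le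
      have h2 : S \ T = ∅ := Finset.disjoint_self_iff_empty _ |>.mp
        (Finset.disjoint_of_subset_right h1 Finset.sdiff_disjoint)
      exact hne (h2 ▸ hmem)
    refine Finset.sum_bij' (fun p _ => ⟨insert (S \ p.1) p.2, S \ p.1⟩)
      (fun p _ => ⟨S \ p.2, p.1.erase p.2⟩) ?_ ?_ ?_ ?_ ?_
    · rintro ⟨T, Q⟩ hp
      rw [Finset.mem_sigma] at hp
      have hTS := hp.1
      simp only [Finset.mem_erase, Finset.mem_filter, Finset.mem_powerset] at hTS
      obtain ⟨hTne, hTS, hxT⟩ := hTS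
      obtain ⟨hd, hs, hne⟩ := mem_setPartitions.mp hp.2
      simp only [Finset.mem_sigma, Finset.mem_filter, Finset.mem_insert_self, true_and,
        mem_setPartitions, Finset.sup_insert, Finset.mem_insert, not_or, Finset.coe_insert]
      refine ⟨⟨?_, ?_, ?_, hne⟩, by simp [hxT]⟩
      · refine hd.insert fun B hB _ => ?_
        have h1 : B ⊆ T := (Finset.le_sup (f := id) hB).trans hs.le
        exact Finset.disjoint_of_subset_right h1 Finset.sdiff_disjoint
      · rw [hs]; exact Finset.sdiff_union_of_subset hTS
      · intro h
        exact hTne (Finset.Subset.antisymm hTS (Finset.sdiff_eq_empty_iff_subset.mp h.symm))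
    · rintro ⟨Q, B⟩ hp
      simp only [Finset.mem_sigma, Finset.mem_filter] at hp
      obtain ⟨hQ, hB, hxB⟩ := hp
      obtain ⟨hd, hs, hne⟩ := mem_setPartitions.mp hQ
      have hBS : B ⊆ S := hs ▸ Finset.le_sup (f := id) hB
      have hBne : B ≠ ∅ := fun h => hne (h ▸ hB)
      simp only [Finset.mem_sigma, Finset.mem_erase, Finset.mem_filter, Finset.mem_powerset,
        mem_setPartitions, Finset.sdiff_subset, Finset.mem_sdiff, hx, hxB, not_false_eq_true, and_true]
      refine ⟨fun h => hBne ?_, ?_, ?_, fun h => hne h.2⟩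
      · rw [← Finset.sdiff_sdiff_eq_self hBS, h, Finset.sdiff_self]
      · exact hd.subset (by simp)
      · ext y
        simp only [Finset.mem_sup, Finset.mem_erase, id, Finset.mem_sdiff]
        constructor
        · rintro ⟨A, ⟨hAB, hA⟩, hy⟩
          exact ⟨hs ▸ Finset.mem_sup.mpr ⟨A, hA, hy⟩,
            fun hyB => Finset.disjoint_left.mp (hd hA hB hAB) hy hyB⟩
        · rintro ⟨hyS, hyB⟩
          rw [← hs, Finset.mem_sup] at hyS
          obtain ⟨A, hA, hy⟩ := hyS
          exact ⟨A, ⟨by rintro rfl; exact hyB hy, hA⟩, hy⟩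
    · rintro ⟨T, Q⟩ hp
      rw [Finset.mem_sigma] at hp
      have h1 := key T hp.1 Q hp.2
      have h2 := hp.1
      simp only [Finset.mem_erase, Finset.mem_filter, Finset.mem_powerset] at h2
      simp only [Finset.erase_insert h1, Finset.sdiff_sdiff_eq_self h2.2.1]
    · rintro ⟨Q, B⟩ hp
      simp only [Finset.mem_sigma, Finset.mem_filter] at hp
      obtain ⟨hQ, hB, hxB⟩ := hp
      obtain ⟨hd, hs, hne⟩ := mem_setPartitions.mp hQ
      have hBS : B ⊆ S := hs ▸ Finset.le_sup (f := id) hB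
      simp only [Finset.sdiff_sdiff_eq_self hBS, Finset.insert_erase hB]
    · rintro ⟨T, Q⟩ hp
      rw [Finset.mem_sigma] at hp
      have h1 := key T hp.1 Q hp.2
      simp only [Finset.prod_insert h1, Finset.card_insert_of_notMem h1, hc,
        Nat.add_sub_cancel]
      ring
  rw [hproper]
  unfold setCumulant
  rw [← Finset.sum_add_distrib]
  -- A partition with `k` blocks has `k - 1` blocks missing `x`. For `k ≥ 2`, `(-1)^(k-1) (k-1)!`
  -- cancels against `(k-1) · (-1)^(k-2) (k-2)!`; only the one-block partition survives.
  have hterm : ∀ Q ∈ setPartitions S, (-1) ^ (Q.card - 1) * ((Q.card - 1).factorial : ℝ) *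
      ∏ B ∈ Q, m B + ∑ B ∈ Q.filter (fun B => x ∉ B), c (Q.card - 1) * ∏ B ∈ Q, m B =
      if Q = {S} then m S else 0 := by
    intro Q hQ
    obtain ⟨B, hB, hxB, hfil⟩ := exists_mem_of_mem_setPartitions hQ hx
    rw [hfil, Finset.sum_const, Finset.card_erase_of_mem hB]
    have hpos : 0 < Q.card := Finset.card_pos.mpr ⟨B, hB⟩
    split_ifs with h
    · subst h; simp
    · have h2 : 2 ≤ Q.card := by
        by_contra hlt
        have h1 : Q.card = 1 := by omega
        obtain ⟨A, rfl⟩ := Finset.card_eq_one.mp h1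
        have := (mem_setPartitions.mp hQ).2.1
        simp only [Finset.sup_singleton, id] at this
        exact h (by rw [this])
      obtain ⟨k, hk⟩ := Nat.exists_eq_add_of_le' h2
      simp only [hc, hk, nsmul_eq_mul, show k + 2 - 1 = k + 1 by omega, Nat.add_sub_cancel,
        Nat.factorial_succ]
      push_cast
      ring
  rw [Finset.sum_congr rfl hterm, Finset.sum_ite_eq', if_pos]
  rw [mem_setPartitions]
  refine ⟨by simp, by simp, ?_⟩
  simp only [Finset.mem_singleton]
  exact fun h => by simp [← h] at hx

end SetPartitions

/-! ### From labelled sets to multi-indices. -/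

section MultiIndices

variable {n : ℕ} {ι : Type*}

/-- The multi-index of a finite set of labelled objects. -/
def labelCount [DecidableEq ι] (l : ι → Fin n) (T : Finset ι) : Fin n → ℕ :=
  fun j => (T.filter fun s => l s = j).card

lemma prod_label_eq [DecidableEq ι] (l : ι → Fin n) (T : Finset ι) (x : Fin n → ℝ) :
    ∏ s ∈ T, x (l s) = ∏ j, x j ^ labelCount l T j := by
  rw [← Finset.prod_fiberwise T l]
  refine Finset.prod_congr rfl fun j _ => ?_
  rw [Finset.prod_congr rfl fun s hs => by rw [(Finset.mem_filter.mp hs).2], Finset.prod_const]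
  rfl

/-- The moment `𝔼 ∏ X_j ^ α_j`. -/
noncomputable def multiMoment (P : Measure (Fin n → ℝ)) (α : Fin n → ℕ) : ℝ :=
  ∫ x, ∏ j, x j ^ α j ∂P

/-- Enumerating each fibre of `l` on `T` identifies `T` with the sigma type in `cumulant`, so only
the multiplicities of the labels matter. -/
lemma setCumulant_label [Fintype ι] [DecidableEq ι] (P : Measure (Fin n → ℝ)) (l : ι → Fin n)
    (T : Finset ι) :
    setCumulant (fun B => ∫ x, ∏ s ∈ B, x (l s) ∂P) T = cumulant P (labelCount l T) := by
  let F : Fin n → Finset ι := fun j => T.filter fun s => l s = j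
  let φ : (Σ j : Fin n, Fin (labelCount l T j)) → ι := fun p => ((F p.1).equivFin.symm p.2 : F p.1)
  have hφ (p) : φ p ∈ T ∧ l (φ p) = p.1 :=
    Finset.mem_filter.mp ((F p.1).equivFin.symm p.2).2
  have hinj : Function.Injective φ := by
    rintro ⟨j, a⟩ ⟨j', a'⟩ h
    have hj : j = j' := by
      have h1 := (hφ ⟨j, a⟩).2
      rw [h, (hφ ⟨j', a'⟩).2] at h1
      exact h1.symm
    subst hj
    have h2 : (F j).equivFin.symm a = (F j).equivFin.symm a' := Subtype.ext h
    rw [(F j).equivFin.symm.injective h2]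
  have hmap : Finset.univ.map ⟨φ, hinj⟩ = T := by
    ext s
    simp only [Finset.mem_map, Finset.mem_univ, true_and, Function.Embedding.coeFn_mk]
    constructor
    · rintro ⟨p, rfl⟩; exact (hφ p).1
    · intro hs
      have hsF : s ∈ F (l s) := by simp [F, hs]
      exact ⟨⟨l s, (F (l s)).equivFin ⟨s, hsF⟩⟩, by simp [φ]⟩
  rw [cumulant, jointCumulant_eq_setCumulant]
  conv_lhs => rw [← hmap, ← setCumulant_map]
  congr 1
  ext B
  refine integral_congr_ae (Filter.Eventually.of_forall fun x => ?_)
  simp only [Finset.prod_map, Function.Embedding.coeFn_mk]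
  exact Finset.prod_congr rfl fun p _ => by rw [(hφ p).2]

/-- The number of sub-multisets of a given type. -/
lemma card_labelCount_eq (α β : Fin n → ℕ) :
    (Finset.univ.filter fun T : Finset (Σ j : Fin n, Fin (α j)) =>
      labelCount Sigma.fst T = β).card = ∏ j, (α j).choose (β j) := by
  have h : ∏ j, (α j).choose (β j) =
      (Fintype.piFinset fun j => (Finset.univ : Finset (Fin (α j))).powersetCard (β j)).card := by
    simp
  have hslice (T : Finset (Σ j : Fin n, Fin (α j))) (j : Fin n) :
      labelCount Sigma.fst T j = (Finset.univ.filter fun a : Fin (α j) => ⟨j, a⟩ ∈ T).card := by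
    unfold labelCount
    symm
    refine Finset.card_bij (fun a _ => ⟨j, a⟩) (by simp) (by simp) ?_
    rintro ⟨j', a⟩ hs
    simp only [Finset.mem_filter] at hs
    obtain ⟨hs, rfl⟩ := hs
    exact ⟨a, by simpa using hs, rfl⟩
  rw [h]
  refine Finset.card_bij' (fun T _ j => Finset.univ.filter fun a : Fin (α j) => ⟨j, a⟩ ∈ T)
    (fun g _ => Finset.univ.sigma g) ?_ ?_ ?_ ?_
  · intro T hT
    simp only [Finset.mem_filter, Finset.mem_univ, true_and] at hT
    simp only [Fintype.mem_piFinset, Finset.mem_powersetCard, Finset.subset_univ, true_and]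
    intro j
    rw [← hslice, hT]
  · intro g hg
    simp only [Fintype.mem_piFinset, Finset.mem_powersetCard, Finset.subset_univ, true_and] at hg
    simp only [Finset.mem_filter, Finset.mem_univ, true_and]
    ext j
    rw [hslice, ← hg j]
    congr 1
    ext a
    simp
  · intro T _
    ext ⟨j, a⟩
    simp
  · intro g _
    ext j a
    simp

/-- Grouping subsets by their label counts is the source of the binomial weights in the moment
recursion. -/
lemma sum_labelCount (α : Fin n → ℕ) (F : (Fin n → ℕ) → ℝ) :
    ∑ T : Finset (Σ j : Fin n, Fin (α j)), F (labelCount Sigma.fst T) =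
      ∑ β ∈ Finset.Iic α, (∏ j, ((α j).choose (β j) : ℝ)) * F β := by
  have hle : ∀ T ∈ (Finset.univ : Finset (Finset (Σ j : Fin n, Fin (α j)))),
      labelCount Sigma.fst T ∈ Finset.Iic α := by
    intro T _
    rw [Finset.mem_Iic]
    intro j
    by_contra hlt
    have h1 := card_labelCount_eq α (labelCount Sigma.fst T)
    rw [Finset.prod_eq_zero (Finset.mem_univ j) (Nat.choose_eq_zero_of_lt (not_le.mp hlt)),
      Finset.card_eq_zero] at h1
    have h2 : T ∈ Finset.univ.filter fun T' : Finset (Σ j : Fin n, Fin (α j)) =>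
      labelCount Sigma.fst T' = labelCount Sigma.fst T := by simp
    rw [h1] at h2
    simp at h2
  rw [← Finset.sum_fiberwise_of_maps_to hle]
  refine Finset.sum_congr rfl fun β _ => ?_
  rw [Finset.sum_congr rfl fun T hT => by rw [(Finset.mem_filter.mp hT).2], Finset.sum_const,
    card_labelCount_eq, nsmul_eq_mul]
  push_cast
  rfl

lemma labelCount_univ_sigma (α : Fin n → ℕ) :
    labelCount Sigma.fst (Finset.univ : Finset (Σ j : Fin n, Fin (α j))) = α := by
  ext j
  unfold labelCount
  have : (Finset.univ.filter fun s : Σ j : Fin n, Fin (α j) => s.1 = j) =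
      (Finset.univ : Finset (Fin (α j))).map (Function.Embedding.sigmaMk j) := by
    ext ⟨j', a⟩
    simp only [Finset.mem_filter, Finset.mem_univ, true_and, Finset.mem_map,
      Function.Embedding.sigmaMk_apply]
    constructor
    · rintro rfl; exact ⟨a, rfl⟩
    · rintro ⟨b, hb⟩; exact (congrArg Sigma.fst hb).symm
  rw [this]; simp

/-- The recursion that expresses moments through cumulants and lower moments. -/
lemma multiMoment_add_single (P : Measure (Fin n → ℝ)) [IsProbabilityMeasure P] (i : Fin n)
    (α : Fin n → ℕ) :
    multiMoment P (α + Pi.single i 1) = ∑ β ∈ Finset.Iic α, (∏ j, ((α j).choose (β j) : ℝ)) *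
      (cumulant P (β + Pi.single i 1) * multiMoment P (α - β)) := by
  -- `none` is the extra copy of `X_i` and serves as the distinguished element; blocks containing it
  -- are the sets `T.insertNone`.
  let l : Option (Σ j : Fin n, Fin (α j)) → Fin n := fun o => o.elim i Sigma.fst
  have hcount (T : Finset (Σ j : Fin n, Fin (α j))) :
      labelCount l T.insertNone = labelCount Sigma.fst T + Pi.single i 1 := by
    ext j
    rw [labelCount, Finset.card_filter, Finset.sum_insertNone, Pi.add_apply, labelCount,
      Finset.card_filter, Pi.single_apply, add_comm]
    simp only [l, Option.elim, eq_comm (a := j)]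
    congr
  have hcompl (T : Finset (Σ j : Fin n, Fin (α j))) :
      labelCount l (Finset.univ \ T.insertNone) = α - labelCount Sigma.fst T := by
    have h1 : (Finset.univ : Finset (Option (Σ j : Fin n, Fin (α j)))) =
      Finset.insertNone Finset.univ := by ext o; simp
    ext j
    have h2 : labelCount l (Finset.univ \ T.insertNone) j + labelCount l T.insertNone j =
        labelCount l Finset.univ j := by
      simp only [labelCount]
      rw [← Finset.card_union_of_disjoint, ← Finset.filter_union,
        Finset.sdiff_union_of_subset (Finset.subset_univ _)]
      exact Finset.disjoint_filter_filter Finset.sdiff_disjoint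
    rw [h1, hcount, hcount, labelCount_univ_sigma, ← h1] at h2
    simp only [Pi.add_apply, Pi.sub_apply] at h2 ⊢
    omega
  have hrec := eq_sum_setCumulant_mul (fun B => ∫ x : Fin n → ℝ, ∏ s ∈ B, x (l s) ∂P) (by simp)
    (Finset.mem_univ (none : Option (Σ j : Fin n, Fin (α j))))
  have huniv : (Finset.univ : Finset (Option (Σ j : Fin n, Fin (α j)))) =
      Finset.insertNone Finset.univ := by ext o; simp
  have hmom (B) : ∫ x : Fin n → ℝ, ∏ s ∈ B, x (l s) ∂P = multiMoment P (labelCount l B) := by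
    simp only [prod_label_eq]; rfl
  simp only [setCumulant_label] at hrec
  simp only [hmom] at hrec
  rw [huniv, hcount, labelCount_univ_sigma] at hrec
  rw [hrec]
  refine Eq.trans ?_ (sum_labelCount α
    fun β => cumulant P (β + Pi.single i 1) * multiMoment P (α - β))
  refine Finset.sum_bij' (fun T _ => Finset.eraseNone T) (fun T _ => T.insertNone) ?_ ?_ ?_ ?_ ?_
  · simp
  · intro T _
    simp [← huniv]
  · intro T hT
    simp only [Finset.mem_filter] at hT
    rw [Finset.insertNone_eraseNone, Finset.insert_eq_of_mem hT.2]
  · simp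
  · intro T hT
    simp only [Finset.mem_filter] at hT
    have hT' : T = (Finset.eraseNone T).insertNone := by
      rw [Finset.insertNone_eraseNone, Finset.insert_eq_of_mem hT.2]
    rw [← hcount, ← hcompl, ← hT', huniv]

end MultiIndices

end GaussianAdditive

/-! ### The dual certificate and the cumulant bound. -/

namespace GaussianAdditive

open MeasureTheory ProbabilityTheory

lemma sq_integral_mul_le {Ω : Type*} [MeasurableSpace Ω] {μ : Measure Ω} {f g : Ω → ℝ}
    (hf : HasAllMoments f μ) (hg : HasAllMoments g μ) :
    (∫ x, f x * g x ∂μ) ^ 2 ≤ (∫ x, f x ^ 2 ∂μ) * ∫ x, g x ^ 2 ∂μ := by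
  have hff : Integrable (fun x => f x ^ 2) μ := by simpa only [sq] using (hf.mul hf).integrable
  have hgg : Integrable (fun x => g x ^ 2) μ := by simpa only [sq] using (hg.mul hg).integrable
  have hfg := (hf.mul hg).integrable
  have h : ∀ t : ℝ, 0 ≤ (∫ x, g x ^ 2 ∂μ) * (t * t) + (2 * ∫ x, f x * g x ∂μ) * t +
      ∫ x, f x ^ 2 ∂μ := by
    intro t
    have h1 : 0 ≤ ∫ x, (f x + t * g x) ^ 2 ∂μ := integral_nonneg fun x => sq_nonneg _
    have h2 : (fun x => (f x + t * g x) ^ 2) =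
        fun x => f x ^ 2 + (2 * t * (f x * g x) + t ^ 2 * g x ^ 2) := by ext x; ring
    have h3 : Integrable (fun x => 2 * t * (f x * g x) + t ^ 2 * g x ^ 2) μ :=
      (hfg.const_mul _).add (hgg.const_mul _)
    rw [h2, integral_add hff h3, integral_add (hfg.const_mul _) (hgg.const_mul _),
      integral_const_mul, integral_const_mul] at h1
    linarith
  have := discrim_le_zero h
  rw [discrim] at this
  linarith

variable {n : ℕ}

/-- The multi-indices of order at most `d`. -/
def multiIndicesLE (n d : ℕ) : Finset (Fin n → ℕ) :=
  (Finset.Iic fun _ => d).filter fun β => ∑ j, β j ≤ d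

lemma mem_multiIndicesLE {d : ℕ} {β : Fin n → ℕ} :
    β ∈ multiIndicesLE n d ↔ ∑ j, β j ≤ d := by
  simp only [multiIndicesLE, Finset.mem_filter, Finset.mem_Iic, and_iff_right_iff_imp]
  exact fun h j => (Finset.single_le_sum (fun _ _ => Nat.zero_le _) (Finset.mem_univ j)).trans h

lemma sum_multiIndicesLE (d : ℕ) (F : (Fin n → ℕ) → ℝ) :
    ∑ β ∈ multiIndicesLE n d, F β =
      ∑ k ∈ Finset.range (d + 1), ∑ β ∈ Finset.piAntidiag Finset.univ k, F β := by
  have hmaps : ∀ β ∈ multiIndicesLE n d, ∑ j, β j ∈ Finset.range (d + 1) := fun β hβ =>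
    Finset.mem_range_succ_iff.mpr (mem_multiIndicesLE.mp hβ)
  rw [← Finset.sum_fiberwise_of_maps_to hmaps]
  refine Finset.sum_congr rfl fun k hk => Finset.sum_congr ?_ fun _ _ => rfl
  ext β
  rw [Finset.mem_range_succ_iff] at hk
  simp only [Finset.mem_filter, mem_multiIndicesLE, Finset.mem_piAntidiag, Finset.mem_univ,
    implies_true, and_true, and_iff_right_iff_imp]
  exact fun h => h.trans_le hk

/-- The product `β!` of the factorials of the entries. -/
def multiFactorial (β : Fin n → ℕ) : ℕ := ∏ j, (β j).factorial

lemma multiFactorial_pos (β : Fin n → ℕ) : 0 < (multiFactorial β : ℝ) := by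
  exact_mod_cast Finset.prod_pos fun j _ => Nat.factorial_pos _

/-- The multivariate Hermite polynomial of multi-index `α`. -/
noncomputable def hermiteProd (α : Fin n → ℕ) (z : Fin n → ℝ) : ℝ :=
  ∏ j, (hermiteReal (α j)).eval (z j)

lemma integral_hermiteProd_mul (α β : Fin n → ℕ) (t : Fin n → ℝ) :
    ∫ z, hermiteProd β z * hermiteProd α (fun j => t j + z j)
        ∂(Measure.pi fun _ : Fin n => gaussianReal 0 1) =
      (∏ j, ((α j).descFactorial (β j) : ℝ)) * ∏ j, t j ^ (α j - β j) := by
  simp only [hermiteProd, ← Finset.prod_mul_distrib]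
  rw [integral_fintype_prod_eq_prod (fun j (x : ℝ) =>
    (hermiteReal (β j)).eval x * (hermiteReal (α j)).eval (t j + x))]
  exact Finset.prod_congr rfl fun j _ => integral_hermiteReal_mul_hermiteReal_comp _ _ _

section SignalNoise

lemma HasAllMoments.signal {P : Measure (Fin n → ℝ)} {a : (Fin n → ℝ) → ℝ}
    (ha : HasAllMoments a P) : HasAllMoments (fun ω => a ω.1) (signalNoiseLaw P) :=
  ha.comp measurePreserving_fst

variable {P : Measure (Fin n → ℝ)} [IsProbabilityMeasure P]

instance : IsProbabilityMeasure (signalNoiseLaw P) := by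
  unfold signalNoiseLaw; infer_instance

lemma hasAllMoments_noise (j : Fin n) :
    HasAllMoments (fun ω => ω.2 j) (signalNoiseLaw P) := by
  have h1 : MeasurePreserving (fun ω : (Fin n → ℝ) × (Fin n → ℝ) => ω.2) (signalNoiseLaw P)
    (Measure.pi fun _ => gaussianReal 0 1) := measurePreserving_snd
  exact hasAllMoments_gaussianReal.comp
    ((measurePreserving_eval (fun _ : Fin n => gaussianReal 0 1) j).comp h1)

lemma hasAllMoments_observation (hP : ∀ j, HasAllMoments (fun x => x j) P) (lam : ℝ)
    (j : Fin n) : HasAllMoments (fun ω => observation lam ω j) (signalNoiseLaw P) :=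
  ((hP j).signal.const_mul _).add (hasAllMoments_noise j)

lemma hasAllMoments_hermiteProd {Ω : Type*} [MeasurableSpace Ω] {μ : Measure Ω}
    [IsFiniteMeasure μ] {Y : Ω → Fin n → ℝ} (hY : ∀ j, HasAllMoments (fun ω => Y ω j) μ)
    (α : Fin n → ℕ) : HasAllMoments (fun ω => hermiteProd α (Y ω)) μ :=
  HasAllMoments.prod fun j _ => (hY j).polynomial _

/-- Given the signal, `Y` is the noise translated by `√lam X`, so translated Hermite orthogonality
applies in each coordinate. The cases used later are `lam = 0` (orthogonality), `β = 0` with `a =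
X_i`, and `a = 1`. -/
lemma integral_mul_hermiteProd_mul (hP : ∀ j, HasAllMoments (fun x => x j) P) (lam : ℝ)
    {a : (Fin n → ℝ) → ℝ} (ha : HasAllMoments a P) (α β : Fin n → ℕ) :
    ∫ ω, a ω.1 * (hermiteProd β ω.2 * hermiteProd α (observation lam ω)) ∂signalNoiseLaw P =
      (∏ j, ((α j).descFactorial (β j) : ℝ)) * (√lam ^ (∑ j, (α j - β j)) *
        ∫ x, a x * ∏ j, x j ^ (α j - β j) ∂P) := by
  have hint := (ha.signal.mul ((hasAllMoments_hermiteProd hasAllMoments_noise β).mul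
    (hasAllMoments_hermiteProd (hasAllMoments_observation hP lam) α))).integrable
  rw [signalNoiseLaw] at hint ⊢
  rw [integral_prod _ hint, ← integral_const_mul, ← integral_const_mul]
  refine integral_congr_ae (Filter.Eventually.of_forall fun x => ?_)
  have h := integral_hermiteProd_mul α β fun j => √lam * x j
  have hobs (z : Fin n → ℝ) : observation lam (x, z) = fun j => √lam * x j + z j := rfl
  simp only [integral_const_mul, hobs]
  rw [h]
  simp only [mul_pow, Finset.prod_mul_distrib, Finset.prod_pow_eq_pow_sum]
  ring

lemma integral_hermiteProd_mul_hermiteProd (hP : ∀ j, HasAllMoments (fun x => x j) P)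
    (α β : Fin n → ℕ) :
    ∫ ω, hermiteProd β ω.2 * hermiteProd α ω.2 ∂signalNoiseLaw P =
      if α = β then (multiFactorial β : ℝ) else 0 := by
  have h := integral_mul_hermiteProd_mul hP 0 (HasAllMoments.const 1) α β
  have hobs (ω : (Fin n → ℝ) × (Fin n → ℝ)) : observation 0 ω = ω.2 := by
    ext j; simp [observation]
  simp only [hobs, one_mul, Real.sqrt_zero] at h
  rw [h]
  split_ifs with hαβ
  · subst hαβ
    simp [multiFactorial, Nat.descFactorial_self]
  -- Either a positive power of `√0` appears, or some falling factorial vanishes.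
  · by_cases hle : β ≤ α
    · have : ∑ j, (α j - β j) ≠ 0 := by
        intro h0
        refine hαβ (funext fun j => ?_)
        have h1 := Finset.sum_eq_zero_iff.mp h0 j (Finset.mem_univ j)
        have h2 : β j ≤ α j := hle j
        omega
      simp [zero_pow this]
    · obtain ⟨j, hj⟩ := not_forall.mp hle
      rw [Finset.prod_eq_zero (Finset.mem_univ j), zero_mul]
      simpa [Nat.descFactorial_eq_zero_iff_lt] using hj

/-- The coefficients, in the Hermite basis, of the dual certificate for the coordinate `i`. -/
noncomputable def certificateCoeff (P : Measure (Fin n → ℝ)) (lam : ℝ) (i : Fin n)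
    (β : Fin n → ℕ) : ℝ :=
  √lam ^ (∑ j, β j) * cumulant P (β + Pi.single i 1) / multiFactorial β

/-- A function of the noise with the same correlations as `X_i` with polynomials of degree at most
`d` in the observation. -/
noncomputable def certificate (P : Measure (Fin n → ℝ)) (lam : ℝ) (i : Fin n) (d : ℕ)
    (z : Fin n → ℝ) : ℝ :=
  ∑ β ∈ multiIndicesLE n d, certificateCoeff P lam i β * hermiteProd β z

lemma hasAllMoments_certificate (lam : ℝ) (i : Fin n) (d : ℕ) :
    HasAllMoments (fun ω => certificate P lam i d ω.2) (signalNoiseLaw P) :=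
  HasAllMoments.sum fun β _ => (hasAllMoments_hermiteProd hasAllMoments_noise β).const_mul _

lemma integral_certificate_sq (hP : ∀ j, HasAllMoments (fun x => x j) P) {lam : ℝ}
    (hlam : 0 ≤ lam) (i : Fin n) (d : ℕ) :
    ∫ ω, certificate P lam i d ω.2 ^ 2 ∂signalNoiseLaw P =
      ∑ β ∈ multiIndicesLE n d,
        lam ^ (∑ j, β j) * cumulant P (β + Pi.single i 1) ^ 2 / multiFactorial β := by
  have hint (α β : Fin n → ℕ) := ((hasAllMoments_hermiteProd (hasAllMoments_noise (P := P)) β).mul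
    (hasAllMoments_hermiteProd hasAllMoments_noise α)).const_mul
      (certificateCoeff P lam i β * certificateCoeff P lam i α)
  have e : (fun ω : (Fin n → ℝ) × (Fin n → ℝ) => certificate P lam i d ω.2 ^ 2) =
      fun ω => ∑ β ∈ multiIndicesLE n d, ∑ α ∈ multiIndicesLE n d,
        certificateCoeff P lam i β * certificateCoeff P lam i α *
          (hermiteProd β ω.2 * hermiteProd α ω.2) := by
    ext ω
    rw [sq, certificate, Finset.sum_mul_sum]
    refine Finset.sum_congr rfl fun β _ => Finset.sum_congr rfl fun α _ => by ring
  rw [e, integral_finsetSum _ fun β _ => (HasAllMoments.sum fun α _ => hint α β).integrable]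
  refine Finset.sum_congr rfl fun β hβ => ?_
  rw [integral_finsetSum _ fun α _ => (hint α β).integrable]
  simp only [integral_const_mul, integral_hermiteProd_mul_hermiteProd hP, mul_ite, mul_zero]
  rw [Finset.sum_ite_eq', if_pos hβ, certificateCoeff]
  have h1 := (multiFactorial_pos β).ne'
  have h2 : (√lam ^ (∑ j, β j)) ^ 2 = lam ^ (∑ j, β j) := by
    rw [← pow_mul, mul_comm, pow_mul, Real.sq_sqrt hlam]
  rw [← h2]
  field_simp

/-- The right side is `√lam^|α|` times the moment of `α + e_i`. Since the falling factorial is `β!`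
times a binomial, the left side is the recursion for that moment term by term; this dictates the
coefficients of the certificate. -/
lemma integral_certificate_mul_hermiteProd (hP : ∀ j, HasAllMoments (fun x => x j) P)
    (lam : ℝ) (i : Fin n) {d : ℕ} {α : Fin n → ℕ} (hα : ∑ j, α j ≤ d) :
    ∫ ω, certificate P lam i d ω.2 * hermiteProd α (observation lam ω) ∂signalNoiseLaw P =
      ∫ ω, ω.1 i * hermiteProd α (observation lam ω) ∂signalNoiseLaw P := by
  have hR : ∫ ω, ω.1 i * hermiteProd α (observation lam ω) ∂signalNoiseLaw P =
      √lam ^ (∑ j, α j) * multiMoment P (α + Pi.single i 1) := by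
    have h := integral_mul_hermiteProd_mul hP lam (hP i) α 0
    have h0 (z : Fin n → ℝ) : hermiteProd 0 z = 1 := by simp [hermiteProd]
    simp only [h0, one_mul, Pi.zero_apply, Nat.descFactorial_zero, Nat.cast_one,
      Finset.prod_const_one, Nat.sub_zero] at h
    rw [h, multiMoment]
    congr 2
    ext x
    simp only [Pi.add_apply, pow_add, Finset.prod_mul_distrib, Pi.single_apply, pow_ite, pow_one,
      pow_zero, Finset.prod_ite_eq', Finset.mem_univ, if_true]
    ring
  have hint (β : Fin n → ℕ) := (((hasAllMoments_hermiteProd (hasAllMoments_noise (P := P)) β).mul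
    (hasAllMoments_hermiteProd (hasAllMoments_observation hP lam) α)).const_mul
      (certificateCoeff P lam i β)).integrable
  simp only [certificate, Finset.sum_mul, mul_assoc]
  rw [integral_finsetSum _ fun β _ => hint β, hR, multiMoment_add_single, Finset.mul_sum]
  have hB (β : Fin n → ℕ) : ∫ ω, certificateCoeff P lam i β * (hermiteProd β ω.2 *
      hermiteProd α (observation lam ω)) ∂signalNoiseLaw P =
      certificateCoeff P lam i β * ((∏ j, ((α j).descFactorial (β j) : ℝ)) *
        (√lam ^ (∑ j, (α j - β j)) * multiMoment P (α - β))) := by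
    have h := integral_mul_hermiteProd_mul hP lam (HasAllMoments.const 1) α β
    simp only [one_mul] at h
    rw [integral_const_mul, h]
    rfl
  simp only [hB]
  have hsub : Finset.Iic α ⊆ multiIndicesLE n d := fun β hβ => by
    rw [mem_multiIndicesLE]
    exact (Finset.sum_le_sum fun j _ => Finset.mem_Iic.mp hβ j).trans hα
  rw [← Finset.sum_subset hsub]
  · refine Finset.sum_congr rfl fun β hβ => ?_
    have hle := Finset.mem_Iic.mp hβ
    have hsum : ∑ j, α j = ∑ j, β j + ∑ j, (α j - β j) := by
      rw [← Finset.sum_add_distrib]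
      exact Finset.sum_congr rfl fun j _ => by have : β j ≤ α j := hle j; omega
    have h1 := (multiFactorial_pos β).ne'
    have hdesc : (∏ j, ((α j).descFactorial (β j) : ℝ)) =
        multiFactorial β * ∏ j, ((α j).choose (β j) : ℝ) := by
      simp only [Nat.descFactorial_eq_factorial_mul_choose, multiFactorial]
      push_cast
      rw [Finset.prod_mul_distrib]
    rw [hdesc, certificateCoeff, hsum, pow_add]
    field_simp
  -- Indices outside `Iic α` drop out because a falling factorial is zero, which makes the system
  -- triangular.
  · intro β _ hβ
    obtain ⟨j, hj⟩ := not_forall.mp fun h => hβ (Finset.mem_Iic.mpr h)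
    rw [Finset.prod_eq_zero (Finset.mem_univ j)]
    · ring
    · simpa [Nat.descFactorial_eq_zero_iff_lt] using hj

/-- Polynomials of degree at most `d` are combinations of Hermite polynomials of degree at most
`d`. -/
lemma eval_mem_span_hermiteProd {d : ℕ} {g : MvPolynomial (Fin n) ℝ} (hg : g.totalDegree ≤ d) :
    (fun y => MvPolynomial.eval y g) ∈
      Submodule.span ℝ (hermiteProd '' {α : Fin n → ℕ | ∑ j, α j ≤ d}) := by
  obtain ⟨c, hc⟩ := exists_pow_eq_sum_hermiteReal
  have e : (fun y => MvPolynomial.eval y g) =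
      ∑ s ∈ g.support, g.coeff s • ∑ p ∈ Fintype.piFinset fun j => Finset.range (s j + 1),
        (∏ j, c (s j) (p j)) • hermiteProd p := by
    ext y
    simp only [MvPolynomial.eval_eq', Finset.sum_apply, Pi.smul_apply, smul_eq_mul, hc,
      Finset.prod_univ_sum, hermiteProd, Finset.prod_mul_distrib]
  rw [e]
  refine Submodule.sum_mem _ fun s hs => Submodule.smul_mem _ _ <|
    Submodule.sum_mem _ fun p hp => Submodule.smul_mem _ _ <| Submodule.subset_span ⟨p, ?_, rfl⟩
  have h1 : ∑ j, s j ≤ d := by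
    refine le_trans ?_ ((MvPolynomial.le_totalDegree hs).trans hg)
    rw [Finsupp.sum_fintype _ _ fun _ => rfl]
  refine (Finset.sum_le_sum fun j _ => ?_).trans h1
  exact Finset.mem_range_succ_iff.mp (Fintype.mem_piFinset.mp hp j)

lemma integral_certificate_mul_eval (hP : ∀ j, HasAllMoments (fun x => x j) P)
    (lam : ℝ) (i : Fin n) {d : ℕ} {g : MvPolynomial (Fin n) ℝ} (hg : g.totalDegree ≤ d) :
    ∫ ω, certificate P lam i d ω.2 * MvPolynomial.eval (observation lam ω) g ∂signalNoiseLaw P =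
      ∫ ω, ω.1 i * MvPolynomial.eval (observation lam ω) g ∂signalNoiseLaw P := by
  have hW := hasAllMoments_certificate (P := P) lam i d
  have hX := (hP i).signal
  -- Moments are carried through the span induction because additivity of the integral needs
  -- integrability.
  have key : ∀ h ∈ Submodule.span ℝ (hermiteProd '' {α : Fin n → ℕ | ∑ j, α j ≤ d}),
      HasAllMoments (fun ω => h (observation lam ω)) (signalNoiseLaw P) ∧
      ∫ ω, certificate P lam i d ω.2 * h (observation lam ω) ∂signalNoiseLaw P =
        ∫ ω, ω.1 i * h (observation lam ω) ∂signalNoiseLaw P := by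
    intro h hh
    induction hh using Submodule.span_induction with
    | mem h hh =>
      obtain ⟨α, hα, rfl⟩ := hh
      exact ⟨hasAllMoments_hermiteProd (hasAllMoments_observation hP lam) α,
        integral_certificate_mul_hermiteProd hP lam i hα⟩
    | zero => exact ⟨HasAllMoments.const 0, by simp⟩
    | add h k _ _ ih ik =>
      refine ⟨ih.1.add ik.1, ?_⟩
      simp only [Pi.add_apply, mul_add]
      rw [integral_add (hW.mul ih.1).integrable (hW.mul ik.1).integrable,
        integral_add (hX.mul ih.1).integrable (hX.mul ik.1).integrable, ih.2, ik.2]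
    | smul a h _ ih =>
      refine ⟨ih.1.const_mul a, ?_⟩
      simp only [Pi.smul_apply, smul_eq_mul, mul_left_comm _ a]
      rw [integral_const_mul, integral_const_mul, ih.2]
  exact (key _ (eval_mem_span_hermiteProd hg)).2

/-- The cumulant bound on the low-degree correlation. -/
lemma lowDegreeCorr_sq_le (hP : ∀ j, HasAllMoments (fun x => x j) P) {lam : ℝ}
    (hlam : 0 ≤ lam) (d : ℕ) :
    lowDegreeCorr P d lam ^ 2 ≤ ∑ i : Fin n, ∑ β ∈ multiIndicesLE n d,
      lam ^ (∑ j, β j) * cumulant P (β + Pi.single i 1) ^ 2 / multiFactorial β := by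
  rw [lowDegreeCorr, Real.sq_sqrt]
  · refine Finset.sum_le_sum fun i _ => Real.sSup_le ?_ ?_
    · rintro _ ⟨g, hg, hg1, rfl⟩
      have h := sq_integral_mul_le (hasAllMoments_certificate (P := P) lam i d)
        (HasAllMoments.mvPolynomial (hasAllMoments_observation hP lam) g)
      rw [integral_certificate_mul_eval hP lam i hg, hg1, mul_one,
        integral_certificate_sq hP hlam] at h
      simpa only [mul_comm] using h
    -- `Real.sSup_le` needs a nonnegative bound, since the supremum of the empty set is `0`.
    · exact Finset.sum_nonneg fun β _ => by
        have := multiFactorial_pos β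
        positivity
  · refine Finset.sum_nonneg fun i _ => Real.sSup_nonneg ?_
    rintro _ ⟨g, -, -, rfl⟩
    positivity

end SignalNoise

end GaussianAdditive

/-! ### From cumulants to moments of the overlap. -/

namespace GaussianAdditive

open MeasureTheory ProbabilityTheory

variable {n : ℕ}

/-- The overlap `⟨x, x'⟩` of a pair of signals. -/
def overlap (x : (Fin n → ℝ) × (Fin n → ℝ)) : ℝ := ∑ i, x.1 i * x.2 i

/-- The `k`-th moment of the overlap of two independent signals. -/
noncomputable def overlapMoment (P : Measure (Fin n → ℝ)) (k : ℕ) : ℝ :=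
  ∫ x, overlap x ^ k ∂P.prod P

lemma multiMoment_add_single_eq (P : Measure (Fin n → ℝ)) (i : Fin n) (β : Fin n → ℕ) :
    multiMoment P (β + Pi.single i 1) = ∫ x, x i * ∏ j, x j ^ β j ∂P := by
  rw [multiMoment]
  congr 1
  ext x
  simp only [Pi.add_apply, pow_add, Finset.prod_mul_distrib, Pi.single_apply, pow_ite, pow_one,
    pow_zero, Finset.prod_ite_eq', Finset.mem_univ, if_true]
  ring

lemma mem_piAntidiag_univ {k : ℕ} {β : Fin n → ℕ} :
    β ∈ Finset.piAntidiag Finset.univ k ↔ ∑ j, β j = k := by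
  simp [Finset.mem_piAntidiag]

lemma sum_add_single (β : Fin n → ℕ) (i : Fin n) :
    ∑ j, (β + Pi.single i 1 : Fin n → ℕ) j = ∑ j, β j + 1 := by
  simp [Finset.sum_add_distrib]

section Moments

variable {P : Measure (Fin n → ℝ)} [IsProbabilityMeasure P]

/-- The multinomial theorem splits the power into monomials, and independence of the two replicas
turns each into the square of one moment. -/
lemma integral_mul_mul_overlap_pow (hP : ∀ j, HasAllMoments (fun x => x j) P)
    {a : (Fin n → ℝ) → ℝ} (ha : HasAllMoments a P) (k : ℕ) :
    ∫ x, a x.1 * a x.2 * overlap x ^ k ∂P.prod P =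
      k.factorial * ∑ β ∈ Finset.piAntidiag Finset.univ k,
        (∫ x, a x * ∏ j, x j ^ β j ∂P) ^ 2 / multiFactorial β := by
  have hmon (β : Fin n → ℕ) : HasAllMoments (fun x => a x * ∏ j, x j ^ β j) P :=
    ha.mul (HasAllMoments.prod fun j _ => (hP j).pow _)
  have e : (fun x : (Fin n → ℝ) × (Fin n → ℝ) => a x.1 * a x.2 * overlap x ^ k) =
      fun x => ∑ β ∈ Finset.piAntidiag Finset.univ k,
        (Nat.multinomial Finset.univ β : ℝ) *
          ((a x.1 * ∏ j, x.1 j ^ β j) * (a x.2 * ∏ j, x.2 j ^ β j)) := by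
    ext x
    rw [overlap, Finset.sum_pow_eq_sum_piAntidiag, Finset.mul_sum]
    refine Finset.sum_congr rfl fun β _ => ?_
    simp only [mul_pow, Finset.prod_mul_distrib]
    ring
  rw [e, integral_finsetSum, Finset.mul_sum]
  · refine Finset.sum_congr rfl fun β hβ => ?_
    rw [integral_const_mul, integral_prod_mul (fun x => a x * ∏ j, x j ^ β j)
      (fun x => a x * ∏ j, x j ^ β j), ← sq]
    have h := Nat.multinomial_spec Finset.univ β
    rw [mem_piAntidiag_univ.mp hβ] at h
    have h1 := (multiFactorial_pos β).ne'
    rw [← h]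
    push_cast
    rw [multiFactorial] at *
    push_cast at *
    field_simp
  · exact fun β _ => (((hmon β).comp measurePreserving_fst).mul
      ((hmon β).comp measurePreserving_snd)).const_mul _ |>.integrable

lemma sum_multiMoment_sq (hP : ∀ j, HasAllMoments (fun x => x j) P) (k : ℕ) :
    ∑ β ∈ Finset.piAntidiag Finset.univ k, multiMoment P β ^ 2 / multiFactorial β =
      overlapMoment P k / k.factorial := by
  have h := integral_mul_mul_overlap_pow hP (HasAllMoments.const 1) k
  simp only [one_mul] at h
  rw [overlapMoment, h, mul_div_cancel_left₀ _ (by exact_mod_cast k.factorial_ne_zero)]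
  rfl

lemma hasAllMoments_overlap (hP : ∀ j, HasAllMoments (fun x => x j) P) :
    HasAllMoments (overlap (n := n)) (P.prod P) :=
  HasAllMoments.sum fun i _ => ((hP i).comp measurePreserving_fst).mul
    ((hP i).comp measurePreserving_snd)

/-- Taking `a = X_i` and summing over `i` supplies one further factor of the overlap, hence order `k
+ 1` over `k!`. -/
lemma sum_sum_multiMoment_add_single_sq (hP : ∀ j, HasAllMoments (fun x => x j) P) (k : ℕ) :
    ∑ i, ∑ β ∈ Finset.piAntidiag Finset.univ k,
      multiMoment P (β + Pi.single i 1) ^ 2 / multiFactorial β =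
      overlapMoment P (k + 1) / k.factorial := by
  have hk : (k.factorial : ℝ) ≠ 0 := by exact_mod_cast k.factorial_ne_zero
  have e : (fun x : (Fin n → ℝ) × (Fin n → ℝ) => overlap x ^ (k + 1)) =
      fun x => ∑ i, x.1 i * x.2 i * overlap x ^ k := by
    ext x
    rw [← Finset.sum_mul, pow_succ']
    rfl
  rw [overlapMoment, e, integral_finsetSum, Finset.sum_div]
  · refine Finset.sum_congr rfl fun i _ => ?_
    rw [integral_mul_mul_overlap_pow hP (hP i), mul_div_cancel_left₀ _ hk]
    simp only [multiMoment_add_single_eq]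
  · exact fun i _ => ((((hP i).comp measurePreserving_fst).mul
      ((hP i).comp measurePreserving_snd)).mul ((hasAllMoments_overlap hP).pow k)).integrable

lemma multiMoment_zero : multiMoment P 0 = 1 := by simp [multiMoment]

variable {d : ℕ}

/-- Strong induction on the order: the recursion writes a moment as a nonnegative combination of
cumulants times lower moments. -/
lemma multiMoment_nonneg
    (hκ : ∀ α : Fin n → ℕ, 1 ≤ ∑ i, α i → ∑ i, α i ≤ d → 0 ≤ cumulant P α)
    (α : Fin n → ℕ) (hα : ∑ i, α i ≤ d) : 0 ≤ multiMoment P α := by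
  induction h : ∑ i, α i using Nat.strong_induction_on generalizing α with
  | _ N ih =>
    by_cases h0 : α = 0
    · simp [h0, multiMoment_zero]
    · obtain ⟨i, hi⟩ := Function.ne_iff.mp h0
      have hα' : α = (α - Pi.single i 1) + Pi.single i 1 := by
        refine (tsub_add_cancel_of_le fun j => ?_).symm
        rw [Pi.single_apply]
        split_ifs with hj
        · subst hj; exact Nat.one_le_iff_ne_zero.mpr hi
        · exact Nat.zero_le _
      set γ := α - Pi.single i 1
      have hγ : ∑ j, γ j + 1 = ∑ j, α j := by rw [hα', sum_add_single]
      rw [hα', multiMoment_add_single]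
      refine Finset.sum_nonneg fun β hβ => ?_
      have hle : ∑ j, β j ≤ ∑ j, γ j := Finset.sum_le_sum fun j _ => Finset.mem_Iic.mp hβ j
      have hle2 : ∑ j, (γ - β) j ≤ ∑ j, γ j :=
        Finset.sum_le_sum fun j _ => Nat.sub_le _ _
      refine mul_nonneg (by positivity) (mul_nonneg (hκ _ ?_ ?_) (ih _ ?_ _ ?_ rfl))
      · rw [sum_add_single]; omega
      · rw [sum_add_single]; omega
      · omega
      · omega

/-- The cumulant is itself one term, `γ = β`, of a recursion with nonnegative terms. -/
lemma cumulant_le_multiMoment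
    (hκ : ∀ α : Fin n → ℕ, 1 ≤ ∑ i, α i → ∑ i, α i ≤ d → 0 ≤ cumulant P α)
    (i : Fin n) (β : Fin n → ℕ) (hβ : ∑ j, β j < d) :
    0 ≤ cumulant P (β + Pi.single i 1) ∧
      cumulant P (β + Pi.single i 1) ≤ multiMoment P (β + Pi.single i 1) := by
  have hnn (γ : Fin n → ℕ) (hγ : γ ≤ β) : 0 ≤ cumulant P (γ + Pi.single i 1) := by
    have hle : ∑ j, γ j ≤ ∑ j, β j := Finset.sum_le_sum fun j _ => hγ j
    exact hκ _ (by rw [sum_add_single]; omega) (by rw [sum_add_single]; omega)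
  refine ⟨hnn β le_rfl, ?_⟩
  rw [multiMoment_add_single]
  have h := Finset.single_le_sum (s := Finset.Iic β) (f := fun γ =>
    (∏ j, ((β j).choose (γ j) : ℝ)) * (cumulant P (γ + Pi.single i 1) * multiMoment P (β - γ)))
    (fun γ hγ => ?_) (Finset.mem_Iic.mpr le_rfl)
  · simpa [multiMoment_zero] using h
  · have hle2 : ∑ j, (β - γ) j ≤ ∑ j, β j := Finset.sum_le_sum fun j _ => Nat.sub_le _ _
    exact mul_nonneg (by positivity) (mul_nonneg (hnn γ (Finset.mem_Iic.mp hγ))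
      (multiMoment_nonneg hκ _ (by omega)))

lemma sum_prod_choose (α : Fin n → ℕ) :
    ∑ β ∈ Finset.Iic α, ∏ j, ((α j).choose (β j) : ℝ) = 2 ^ ∑ j, α j := by
  have h := sum_labelCount α fun _ => 1
  simp only [mul_one] at h
  rw [← h]
  simp

lemma prod_choose_div_multiFactorial {α β : Fin n → ℕ} (h : β ≤ α) :
    (∏ j, ((α j).choose (β j) : ℝ)) / multiFactorial α =
      1 / (multiFactorial β * multiFactorial (α - β)) := by
  have h1 := multiFactorial_pos α
  have h2 := multiFactorial_pos β
  have h3 := multiFactorial_pos (α - β)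
  rw [div_eq_div_iff h1.ne' (by positivity), one_mul]
  simp only [multiFactorial]
  push_cast
  rw [← Finset.prod_mul_distrib, ← Finset.prod_mul_distrib]
  refine Finset.prod_congr rfl fun j _ => ?_
  rw [← mul_assoc]
  exact_mod_cast Nat.choose_mul_factorial_mul_factorial (h j)

/-- At the top order no sign of the cumulant is available. -/
lemma cumulant_sq_le
    (hκ : ∀ α : Fin n → ℕ, 1 ≤ ∑ i, α i → ∑ i, α i ≤ d → 0 ≤ cumulant P α)
    (i : Fin n) (α : Fin n → ℕ) (hα : ∑ j, α j = d) :
    cumulant P (α + Pi.single i 1) ^ 2 / multiFactorial α ≤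
      2 * (multiMoment P (α + Pi.single i 1) ^ 2 / multiFactorial α) +
      2 * 2 ^ d * ∑ β ∈ (Finset.Iic α).erase α,
        (multiMoment P (β + Pi.single i 1) ^ 2 / multiFactorial β) *
          (multiMoment P (α - β) ^ 2 / multiFactorial (α - β)) := by
  set s := (Finset.Iic α).erase α
  have hlt : ∀ β ∈ s, ∑ j, β j < d := by
    intro β hβ
    obtain ⟨hne, hle⟩ := Finset.mem_erase.mp hβ
    rw [← hα]
    have hle := Finset.mem_Iic.mp hle
    refine Finset.sum_lt_sum (fun j _ => hle j) ?_
    by_contra! hcon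
    exact hne (le_antisymm hle fun j => hcon j (Finset.mem_univ j))
  have hm : ∀ β : Fin n → ℕ, 0 ≤ multiMoment P (α - β) := fun β =>
    multiMoment_nonneg hκ _ (hα ▸ Finset.sum_le_sum fun j _ => Nat.sub_le _ _)
  set S := ∑ β ∈ s, (∏ j, ((α j).choose (β j) : ℝ)) *
    (cumulant P (β + Pi.single i 1) * multiMoment P (α - β)) with hS
  set T := ∑ β ∈ s, (∏ j, ((α j).choose (β j) : ℝ)) *
    (multiMoment P (β + Pi.single i 1) * multiMoment P (α - β)) with hT
  -- Isolating the top cumulant leaves in `S` only cumulants of order at most `d`, which do have a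
  -- sign and are dominated by moments.
  have hrec : multiMoment P (α + Pi.single i 1) = cumulant P (α + Pi.single i 1) + S := by
    rw [multiMoment_add_single, ← Finset.add_sum_erase _ _ (Finset.mem_Iic.mpr (le_refl α))]
    simp [multiMoment_zero, hS, s]
  have hS0 : 0 ≤ S := Finset.sum_nonneg fun β hβ => mul_nonneg (by positivity)
    (mul_nonneg (cumulant_le_multiMoment hκ i β (hlt β hβ)).1 (hm β))
  have hST : S ≤ T := Finset.sum_le_sum fun β hβ => mul_le_mul_of_nonneg_left
    (mul_le_mul_of_nonneg_right (cumulant_le_multiMoment hκ i β (hlt β hβ)).2 (hm β))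
    (by positivity)
  -- Cauchy–Schwarz with binomial weights, whose total is at most `2 ^ d`.
  have hT2 : T ^ 2 ≤ 2 ^ d * ∑ β ∈ s, (∏ j, ((α j).choose (β j) : ℝ)) *
      (multiMoment P (β + Pi.single i 1) ^ 2 * multiMoment P (α - β) ^ 2) := by
    have h1 : T ^ 2 ≤ (∑ β ∈ s, ∏ j, ((α j).choose (β j) : ℝ)) *
        ∑ β ∈ s, (∏ j, ((α j).choose (β j) : ℝ)) *
          (multiMoment P (β + Pi.single i 1) ^ 2 * multiMoment P (α - β) ^ 2) :=
      Finset.sum_sq_le_sum_mul_sum_of_sq_le_mul s (fun β _ => by positivity)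
        (fun β _ => by positivity) fun β _ => le_of_eq (by ring)
    refine h1.trans (mul_le_mul_of_nonneg_right ?_ (Finset.sum_nonneg fun β _ => by positivity))
    rw [← hα, ← sum_prod_choose]
    exact Finset.sum_le_sum_of_subset_of_nonneg (Finset.erase_subset _ _)
      fun β _ _ => by positivity
  have hα0 := multiFactorial_pos α
  have hsq : cumulant P (α + Pi.single i 1) ^ 2 ≤
      2 * multiMoment P (α + Pi.single i 1) ^ 2 + 2 * T ^ 2 := by
    have h1 : S ^ 2 ≤ T ^ 2 := pow_le_pow_left₀ hS0 hST 2
    rw [← sub_eq_of_eq_add hrec]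
    nlinarith [sq_nonneg (multiMoment P (α + Pi.single i 1) + S)]
  calc cumulant P (α + Pi.single i 1) ^ 2 / multiFactorial α
      ≤ (2 * multiMoment P (α + Pi.single i 1) ^ 2 + 2 * (2 ^ d * ∑ β ∈ s,
          (∏ j, ((α j).choose (β j) : ℝ)) *
          (multiMoment P (β + Pi.single i 1) ^ 2 * multiMoment P (α - β) ^ 2))) /
          multiFactorial α := by
        gcongr
        linarith
    _ = _ := by
        rw [add_div, mul_div_assoc, mul_div_assoc, mul_div_assoc, Finset.sum_div, mul_assoc]
        congr 3
        refine Finset.sum_congr rfl fun β hβ => ?_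
        -- Binomial over `α!` is `1 / (β! (α - β)!)`, so the sum becomes a convolution that factors
        -- after summing over `α`.
        have h := prod_choose_div_multiFactorial
          (Finset.mem_Iic.mp (Finset.mem_of_mem_erase hβ))
        rw [mul_comm (∏ j, ((α j).choose (β j) : ℝ)), mul_div_assoc, h]
        have h2 := multiFactorial_pos β
        have h3 := multiFactorial_pos (α - β)
        field_simp

/-- Reindexing by `α = β + γ`. Leaving out `β = α` leaves out `k = d`, so `γ` always has positive
order. -/
lemma sum_piAntidiag_sum_Iic (F G : (Fin n → ℕ) → ℝ) :
    ∑ α ∈ Finset.piAntidiag Finset.univ d, ∑ β ∈ (Finset.Iic α).erase α, F β * G (α - β) =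
      ∑ k ∈ Finset.range d, (∑ β ∈ Finset.piAntidiag Finset.univ k, F β) *
        ∑ γ ∈ Finset.piAntidiag Finset.univ (d - k), G γ := by
  simp only [Finset.sum_mul_sum, ← Finset.sum_product']
  rw [Finset.sum_sigma', Finset.sum_sigma']
  have hsum {α β : Fin n → ℕ} (h : β ≤ α) : ∑ j, β j + ∑ j, (α - β) j = ∑ j, α j := by
    rw [← Finset.sum_add_distrib]
    exact Finset.sum_congr rfl fun j _ => Nat.add_sub_cancel' (h j)
  refine Finset.sum_bij' (fun p _ => ⟨∑ j, p.2 j, (p.2, p.1 - p.2)⟩)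
    (fun p _ => ⟨p.2.1 + p.2.2, p.2.1⟩) ?_ ?_ ?_ ?_ ?_
  · rintro ⟨α, β⟩ h
    simp only [Finset.mem_sigma, mem_piAntidiag_univ, Finset.mem_erase, Finset.mem_Iic,
      Finset.mem_range, Finset.mem_product, true_and] at h ⊢
    obtain ⟨hα, hne, hle⟩ := h
    have h1 := hsum hle
    refine ⟨?_, by omega⟩
    rw [← hα]
    refine Finset.sum_lt_sum (fun j _ => hle j) ?_
    by_contra! hcon
    exact hne (le_antisymm hle fun j => hcon j (Finset.mem_univ j))
  · rintro ⟨k, β, γ⟩ h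
    simp only [Finset.mem_sigma, mem_piAntidiag_univ, Finset.mem_erase, Finset.mem_Iic,
      Finset.mem_range, Finset.mem_product,
      Pi.add_apply, Finset.sum_add_distrib, le_add_iff_nonneg_right, zero_le, and_true] at h ⊢
    obtain ⟨hk, hβ, hγ⟩ := h
    refine ⟨by omega, fun h0 => ?_⟩
    have h1 : ∑ j, β j = ∑ j, (β + γ) j := by rw [← h0]
    simp only [Pi.add_apply, Finset.sum_add_distrib] at h1
    omega
  · rintro ⟨α, β⟩ h
    simp only [Finset.mem_sigma, Finset.mem_erase, Finset.mem_Iic] at h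
    simp only [add_tsub_cancel_of_le h.2.2]
  · rintro ⟨k, β, γ⟩ h
    simp only [Finset.mem_sigma, mem_piAntidiag_univ, Finset.mem_product] at h
    simp only [add_tsub_cancel_left, h.2.1]
  · rintro ⟨α, β⟩ _
    rfl

/-- The bound on the low-degree correlation in terms of the moments of the overlap. -/
lemma lowDegreeCorr_sq_le_overlapMoment (hP : ∀ j, HasAllMoments (fun x => x j) P)
    (hκ : ∀ α : Fin n → ℕ, 1 ≤ ∑ i, α i → ∑ i, α i ≤ d → 0 ≤ cumulant P α)
    {lam : ℝ} (hlam : 0 ≤ lam) :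
    lowDegreeCorr P d lam ^ 2 ≤
      ∑ k ∈ Finset.range d, lam ^ k * (overlapMoment P (k + 1) / k.factorial) +
      lam ^ d * (2 * (overlapMoment P (d + 1) / d.factorial) +
        2 * 2 ^ d * ∑ k ∈ Finset.range d, (overlapMoment P (k + 1) / k.factorial) *
          (overlapMoment P (d - k) / (d - k).factorial)) := by
  refine (lowDegreeCorr_sq_le hP hlam d).trans ?_
  have hdeg : ∀ k, ∑ i, ∑ β ∈ Finset.piAntidiag Finset.univ k,
      lam ^ (∑ j, β j) * cumulant P (β + Pi.single i 1) ^ 2 / multiFactorial β =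
      lam ^ k * ∑ i, ∑ β ∈ Finset.piAntidiag Finset.univ k,
        cumulant P (β + Pi.single i 1) ^ 2 / multiFactorial β := by
    intro k
    simp only [Finset.mul_sum]
    refine Finset.sum_congr rfl fun i _ => Finset.sum_congr rfl fun β hβ => ?_
    rw [mem_piAntidiag_univ.mp hβ, mul_div_assoc]
  simp only [sum_multiIndicesLE]
  rw [Finset.sum_comm, Finset.sum_range_succ]
  simp only [hdeg]
  refine add_le_add (Finset.sum_le_sum fun k hk => ?_) ?_
  · rw [← sum_sum_multiMoment_add_single_sq hP]
    refine mul_le_mul_of_nonneg_left (Finset.sum_le_sum fun i _ => Finset.sum_le_sum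
      fun β hβ => ?_) (by positivity)
    have hβ' : ∑ j, β j < d := by
      rw [mem_piAntidiag_univ.mp hβ]; exact Finset.mem_range.mp hk
    have h := cumulant_le_multiMoment hκ i β hβ'
    exact div_le_div_of_nonneg_right (pow_le_pow_left₀ h.1 h.2 2) (multiFactorial_pos β).le
  · refine mul_le_mul_of_nonneg_left ?_ (by positivity)
    refine (Finset.sum_le_sum fun i _ => Finset.sum_le_sum fun β hβ =>
      cumulant_sq_le hκ i β (mem_piAntidiag_univ.mp hβ)).trans (le_of_eq ?_)
    simp only [Finset.sum_add_distrib, ← Finset.mul_sum]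
    rw [sum_sum_multiMoment_add_single_sq hP]
    simp only [sum_piAntidiag_sum_Iic
      (fun β => multiMoment P (β + Pi.single _ 1) ^ 2 / multiFactorial β)
      (fun γ => multiMoment P γ ^ 2 / multiFactorial γ), sum_multiMoment_sq hP]
    rw [Finset.sum_comm]
    simp only [← Finset.sum_mul, sum_sum_multiMoment_add_single_sq hP]

/-- If the moments of the overlap are at most those of a constant `q`, up to a constant factor,
then the low-degree correlation is small below the signal-to-noise ratio of order `1 / q`. -/
lemma lowDegreeCorr_sq_le_two_mul (hP : ∀ j, HasAllMoments (fun x => x j) P)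
    (hκ : ∀ α : Fin n → ℕ, 1 ≤ ∑ i, α i → ∑ i, α i ≤ d → 0 ≤ cumulant P α) (hd : 1 ≤ d)
    {lam q : ℝ} (hlam : 0 ≤ lam) (hq : 0 ≤ q) (hlq : lam * q ≤ 1 / 100)
    (hM : ∀ k, 1 ≤ k → k ≤ d + 1 → |overlapMoment P k| ≤ 5 / 4 * q ^ k) :
    lowDegreeCorr P d lam ^ 2 ≤ 2 * q := by
  refine (lowDegreeCorr_sq_le_overlapMoment hP hκ hlam).trans ?_
  have hM' : ∀ k m : ℕ, 1 ≤ k → k ≤ d + 1 →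
      |overlapMoment P k / m.factorial| ≤ 5 / 4 * q ^ k := by
    intro k m h1 h2
    rw [abs_div, Nat.abs_cast]
    refine (div_le_self (abs_nonneg _) ?_).trans (hM k h1 h2)
    exact_mod_cast Nat.one_le_iff_ne_zero.mpr m.factorial_ne_zero
  set t := lam * q with ht
  have ht0 : 0 ≤ t := by positivity
  have h1 : ∑ k ∈ Finset.range d, lam ^ k * (overlapMoment P (k + 1) / k.factorial) ≤
      5 / 4 * q * (100 / 99) := by
    calc _ ≤ ∑ k ∈ Finset.range d, 5 / 4 * q * t ^ k := by
          refine Finset.sum_le_sum fun k hk => ?_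
          have := (le_abs_self _).trans (hM' (k + 1) k (by omega)
            (by have := Finset.mem_range.mp hk; omega))
          calc _ ≤ lam ^ k * (5 / 4 * q ^ (k + 1)) := by gcongr
            _ = _ := by rw [ht]; ring
      _ = 5 / 4 * q * ∑ k ∈ Finset.range d, t ^ k := by rw [Finset.mul_sum]
      _ ≤ 5 / 4 * q * (1 - t)⁻¹ := by
          gcongr
          have hs := summable_geometric_of_lt_one ht0 (by linarith)
          rw [← tsum_geometric_of_lt_one ht0 (by linarith)]
          exact hs.sum_le_tsum _ fun k _ => by positivity
      _ ≤ _ := by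
          gcongr
          rw [show (100 / 99 : ℝ) = (99 / 100)⁻¹ by norm_num]
          gcongr
          linarith
  have hsum : ∑ k ∈ Finset.range d, (overlapMoment P (k + 1) / k.factorial) *
      (overlapMoment P (d - k) / (d - k).factorial) ≤ 2 ^ d * (25 / 16 * q ^ (d + 1)) := by
    calc _ ≤ ∑ k ∈ Finset.range d, 25 / 16 * q ^ (d + 1) := by
          refine Finset.sum_le_sum fun k hk => ?_
          have hk' := Finset.mem_range.mp hk
          have ha := hM' (k + 1) k (by omega) (by omega)
          have hb := hM' (d - k) (d - k) (by omega) (by omega)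
          refine (le_abs_self _).trans ?_
          rw [abs_mul]
          calc _ ≤ (5 / 4 * q ^ (k + 1)) * (5 / 4 * q ^ (d - k)) := by gcongr
            _ = 25 / 16 * (q ^ (k + 1) * q ^ (d - k)) := by ring
            _ = _ := by rw [← pow_add, show k + 1 + (d - k) = d + 1 by omega]
      _ = d * (25 / 16 * q ^ (d + 1)) := by simp
      _ ≤ _ := by
          gcongr
          exact_mod_cast Nat.lt_two_pow_self.le
  have htd : t ^ d ≤ 1 / 100 := (pow_le_of_le_one ht0 (by linarith) (by omega)).trans hlq
  -- The base `4` collects two factors `2 ^ d`: one from the binomial weights, one from bounding the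
  -- number `d` of terms.
  have htd4 : (4 * t) ^ d ≤ 1 / 25 :=
    (pow_le_of_le_one (by positivity) (by linarith) (by omega)).trans (by linarith)
  have h2 : lam ^ d * (2 * (overlapMoment P (d + 1) / d.factorial) +
        2 * 2 ^ d * ∑ k ∈ Finset.range d, (overlapMoment P (k + 1) / k.factorial) *
          (overlapMoment P (d - k) / (d - k).factorial)) ≤ q * (5 / 200 + 25 / 200) := by
    have ha := (le_abs_self _).trans (hM' (d + 1) d (by omega) (by omega))
    calc _ ≤ lam ^ d * (2 * (5 / 4 * q ^ (d + 1)) +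
          2 * 2 ^ d * (2 ^ d * (25 / 16 * q ^ (d + 1)))) := by gcongr
      _ = q * (5 / 2 * t ^ d + 25 / 8 * (4 * t) ^ d) := by
          rw [ht, show (4 : ℝ) = 2 * 2 by norm_num]
          simp only [mul_pow, pow_succ]
          ring
      _ ≤ _ := mul_le_mul_of_nonneg_left (by linarith) hq
  -- The constants fit: `125/99 + 3/20 < 2`.
  linarith

end Moments

end GaussianAdditive

/-! ### The potential's derivative, overlap quantiles and truncation of moments. -/

namespace GaussianAdditive

open MeasureTheory ProbabilityTheory Filter Topology

variable {n : ℕ} {P : Measure (Fin n → ℝ)}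

/-- The tilt `exp (u q)` contributes only the linear term `-u q` to the potential, so `u` cancels
from `u + F'_u`. -/
lemma deriv_annealedFP {f : ℝ → ℝ} {q : ℝ} (u : ℝ) (hf : 0 < f q)
    (hd : DifferentiableAt ℝ f q) :
    deriv (annealedFP f u) q = -u - deriv (fun t => Real.log (f t)) q := by
  have h1 := (hd.hasDerivAt).log hf.ne'
  have h2 : HasDerivAt (fun t => Real.exp (u * t)) (Real.exp (u * q) * u) q := by
    simpa using ((hasDerivAt_id q).const_mul u).exp
  have h3 := ((h2.mul hd.hasDerivAt).log (by simpa using hf.ne')).neg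
  have h4 : annealedFP f u = -fun t => Real.log (((fun t => Real.exp (u * t)) * f) t) := rfl
  rw [h1.deriv, h4, h3.deriv]
  have := (Real.exp_pos (u * q)).ne'
  simp only [Pi.mul_apply]
  field_simp
  ring

lemma overlapLaw_eq : overlapLaw P = (P.prod P).map overlap := rfl

/-- For `y < 0` the event is empty, while `d > 0` requires positive probability. -/
lemma overlapQuantile_set_bddBelow {d : ℝ} (hd : 0 < d) :
    BddBelow {y : ℝ | 1 - Real.exp (-d) ≤ (overlapLaw P).real {s | |s| ≤ y}} := by
  refine ⟨0, fun y hy => ?_⟩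
  by_contra! hneg
  have h0 : {s : ℝ | |s| ≤ y} = ∅ := by
    ext s
    simpa using hneg.trans_le (abs_nonneg s)
  have h1 : Real.exp (-d) < 1 := by rw [Real.exp_lt_one_iff]; linarith
  rw [Set.mem_ofPred_eq, h0, measureReal_empty] at hy
  linarith

variable [IsProbabilityMeasure P]

lemma measurable_overlap : Measurable (overlap (n := n)) := by
  unfold overlap; fun_prop

instance : IsProbabilityMeasure (overlapLaw P) := by
  rw [overlapLaw_eq]
  exact Measure.isProbabilityMeasure_map measurable_overlap.aemeasurable

lemma overlapLaw_real_eq_cdf (y : ℝ) :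
    (overlapLaw P).real {s | |s| ≤ y} = cdf ((overlapLaw P).map fun s => |s|) y := by
  have : IsProbabilityMeasure ((overlapLaw P).map fun s : ℝ => |s|) :=
    Measure.isProbabilityMeasure_map (by fun_prop)
  rw [cdf_eq_real, map_measureReal_apply (by fun_prop) measurableSet_Iic]
  rfl

lemma overlapQuantile_set_nonempty {d : ℝ} :
    {y : ℝ | 1 - Real.exp (-d) ≤ (overlapLaw P).real {s | |s| ≤ y}}.Nonempty := by
  have h := tendsto_cdf_atTop ((overlapLaw P).map fun s : ℝ => |s|)
  have hlt : 1 - Real.exp (-d) < 1 := by linarith [Real.exp_pos (-d)]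
  obtain ⟨y, hy⟩ := (h.eventually (lt_mem_nhds hlt)).exists
  exact ⟨y, by rw [Set.mem_ofPred_eq, overlapLaw_real_eq_cdf]; exact hy.le⟩

lemma overlapQuantile_mono {d e : ℝ} (hd : 0 < d) (hde : d ≤ e) :
    overlapQuantile P d ≤ overlapQuantile P e := by
  refine csInf_le_csInf (overlapQuantile_set_bddBelow hd) overlapQuantile_set_nonempty
    fun y hy => ?_
  have : Real.exp (-e) ≤ Real.exp (-d) := Real.exp_le_exp.mpr (by linarith)
  rw [Set.mem_ofPred_eq] at hy ⊢
  linarith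

/-- The infimum is attained because distribution functions are right-continuous. -/
lemma one_sub_exp_le_overlapQuantile (d : ℝ) :
    1 - Real.exp (-d) ≤ (overlapLaw P).real {s | |s| ≤ overlapQuantile P d} := by
  rw [overlapLaw_real_eq_cdf]
  set F := cdf ((overlapLaw P).map fun s : ℝ => |s|)
  have hcont := (F.right_continuous (overlapQuantile P d)).mono Set.Ioi_subset_Ici_self
  refine ge_of_tendsto hcont ?_
  filter_upwards [self_mem_nhdsWithin] with y hy
  obtain ⟨z, hz, hzy⟩ := exists_lt_of_csInf_lt overlapQuantile_set_nonempty hy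
  rw [Set.mem_ofPred_eq, overlapLaw_real_eq_cdf] at hz
  exact hz.trans (F.mono hzy.le)

lemma measureReal_overlapQuantile_lt (d : ℝ) :
    (P.prod P).real {x | overlapQuantile P d < |overlap x|} ≤ Real.exp (-d) := by
  have h := one_sub_exp_le_overlapQuantile (P := P) d
  have hm : MeasurableSet {s : ℝ | |s| ≤ overlapQuantile P d} :=
    measurableSet_le (by fun_prop) measurable_const
  rw [overlapLaw_eq, map_measureReal_apply measurable_overlap hm] at h
  have hc : {x | overlapQuantile P d < |overlap x|} =
      ((overlap (n := n)) ⁻¹' {s : ℝ | |s| ≤ overlapQuantile P d})ᶜ := by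
    ext x; simp
  rw [hc, probReal_compl_eq_one_sub (measurable_overlap hm)]
  linarith

lemma hasAllMoments_of_isSubWeibull {φ K : ℝ} {i : Fin n}
    (h : IsSubWeibull φ K (fun x : Fin n → ℝ => x i) P) : HasAllMoments (fun x => x i) P := by
  intro p
  have hmeas : AEStronglyMeasurable (fun x : Fin n → ℝ => x i) P :=
    (measurable_pi_apply i).aestronglyMeasurable
  have h1 : MemLp (fun x : Fin n → ℝ => x i) (ENNReal.ofReal ((p : ℝ) + 1)) P :=
    ⟨hmeas, (h _ (by linarith [p.cast_nonneg (α := ℝ)])).trans_lt ENNReal.ofReal_lt_top⟩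
  refine h1.mono_exponent ?_
  rw [← ENNReal.ofReal_natCast]
  exact ENNReal.ofReal_le_ofReal (by linarith)

lemma integral_pow_le_of_isSubWeibull {φ K : ℝ} (hK : 0 ≤ K) {i : Fin n}
    (h : IsSubWeibull φ K (fun x : Fin n → ℝ => x i) P) {k : ℕ} (hk : 1 ≤ k) :
    ∫ x, x i ^ (2 * k) ∂P ≤ (K * (2 * k : ℝ) ^ (1 / φ)) ^ (2 * k) := by
  have hk' : (1 : ℝ) ≤ k := by exact_mod_cast hk
  have h1 := h (2 * k) (by linarith)
  have hpos : (0 : ℝ) < 2 * k := by linarith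
  have hmem : MemLp (fun x : Fin n → ℝ => x i) (ENNReal.ofReal (2 * k)) P := by
    have := hasAllMoments_of_isSubWeibull h (2 * k)
    rwa [← ENNReal.ofReal_natCast, Nat.cast_mul, Nat.cast_ofNat] at this
  have hB : 0 ≤ K * (2 * k : ℝ) ^ (1 / φ) := by positivity
  rw [hmem.eLpNorm_eq_integral_rpow_norm (by simp; omega) ENNReal.ofReal_ne_top,
    ENNReal.ofReal_le_ofReal_iff hB, ENNReal.toReal_ofReal hpos.le] at h1
  have e : ∀ x : ℝ, ‖x‖ ^ (2 * k : ℝ) = x ^ (2 * k) := fun x => by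
    rw [show (2 * k : ℝ) = ((2 * k : ℕ) : ℝ) by push_cast; rfl, Real.rpow_natCast,
      Real.norm_eq_abs, pow_mul, sq_abs, ← pow_mul]
  simp only [e] at h1
  have hI : 0 ≤ ∫ x : Fin n → ℝ, x i ^ (2 * k) ∂P :=
    integral_nonneg fun x => by rw [pow_mul]; positivity
  rw [Real.rpow_inv_le_iff_of_pos hI hB hpos] at h1
  rwa [← Real.rpow_natCast, Nat.cast_mul, Nat.cast_ofNat]

/-- The power-mean inequality over the `n` coordinates, then independence, which squares each
marginal moment. -/
lemma overlapMoment_two_mul_le (hP : ∀ j, HasAllMoments (fun x => x j) P) (hn : 1 ≤ n) {B : ℝ}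
    {k : ℕ} (hk : 1 ≤ k) (hB : ∀ i, ∫ x, x i ^ (2 * k) ∂P ≤ B ^ (2 * k)) :
    overlapMoment P (2 * k) ≤ ((n * B ^ 2) ^ k) ^ 2 := by
  have hn' : (0 : ℝ) < n := by exact_mod_cast hn
  have hpow (i : Fin n) : HasAllMoments (fun x : (Fin n → ℝ) × (Fin n → ℝ) =>
      x.1 i ^ (2 * k) * x.2 i ^ (2 * k)) (P.prod P) :=
    (((hP i).pow _).comp measurePreserving_fst).mul (((hP i).pow _).comp measurePreserving_snd)
  have hpt (x : (Fin n → ℝ) × (Fin n → ℝ)) : overlap x ^ (2 * k) ≤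
      n ^ (2 * k - 1) * ∑ i, x.1 i ^ (2 * k) * x.2 i ^ (2 * k) := by
    have h := pow_sum_div_card_le_sum_pow (s := Finset.univ) (f := fun i => |x.1 i * x.2 i|)
      (fun i _ => abs_nonneg _) (2 * k - 1)
    rw [Finset.card_univ, Fintype.card_fin, div_le_iff₀ (by positivity),
      show 2 * k - 1 + 1 = 2 * k by omega] at h
    calc overlap x ^ (2 * k) = |overlap x| ^ (2 * k) := by
          rw [pow_mul, pow_mul, sq_abs]
      _ ≤ (∑ i, |x.1 i * x.2 i|) ^ (2 * k) := by
          gcongr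
          exact Finset.abs_sum_le_sum_abs _ _
      _ ≤ _ := h
      _ = _ := by
          rw [mul_comm]
          congr 1
          refine Finset.sum_congr rfl fun i _ => ?_
          rw [← mul_pow, pow_mul, pow_mul, sq_abs]
  calc overlapMoment P (2 * k)
      ≤ ∫ x, (n : ℝ) ^ (2 * k - 1) * ∑ i, x.1 i ^ (2 * k) * x.2 i ^ (2 * k) ∂P.prod P :=
        integral_mono ((hasAllMoments_overlap hP).pow _).integrable
          ((HasAllMoments.sum fun i _ => hpow i).const_mul _).integrable hpt
    _ = (n : ℝ) ^ (2 * k - 1) * ∑ i, (∫ x, x i ^ (2 * k) ∂P) ^ 2 := by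
        rw [integral_const_mul, integral_finsetSum _ fun i _ => (hpow i).integrable]
        congr 1
        refine Finset.sum_congr rfl fun i _ => ?_
        rw [integral_prod_mul (fun x : Fin n → ℝ => x i ^ (2 * k))
          (fun x : Fin n → ℝ => x i ^ (2 * k)), sq]
    _ ≤ (n : ℝ) ^ (2 * k - 1) * ∑ i : Fin n, (B ^ (2 * k)) ^ 2 := by
        gcongr with i _
        · exact integral_nonneg fun x => by rw [pow_mul]; positivity
        · exact hB i
    _ = ((n * B ^ 2) ^ k) ^ 2 := by
        rw [Finset.sum_const, Finset.card_univ, Fintype.card_fin, nsmul_eq_mul, ← mul_assoc,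
          ← pow_succ, show 2 * k - 1 + 1 = 2 * k by omega]
        ring

/-- Truncation of the moments of the overlap. -/
lemma abs_overlapMoment_le (hP : ∀ j, HasAllMoments (fun x => x j) P) {q d M : ℝ} (hq : 0 ≤ q)
    (htail : (P.prod P).real {x | q < |overlap x|} ≤ Real.exp (-d)) {k : ℕ}
    (hM : 0 ≤ M) (hmom : overlapMoment P (2 * k) ≤ M ^ 2) :
    |overlapMoment P k| ≤ q ^ k + M * Real.exp (-d / 2) := by
  set s : Set ((Fin n → ℝ) × (Fin n → ℝ)) := {x | q < |overlap x|}
  have hs : MeasurableSet s := measurableSet_lt measurable_const measurable_overlap.abs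
  have hR := (hasAllMoments_overlap hP).pow k
  have hRabs : HasAllMoments (fun x => |overlap x ^ k|) (P.prod P) := fun p => (hR p).abs
  have hind : HasAllMoments (s.indicator fun _ => (1 : ℝ)) (P.prod P) := fun p =>
    (memLp_const 1).indicator hs
  -- Cauchy–Schwarz against the indicator of the tail; the square root of its probability produces
  -- `exp (-d / 2)`.
  have hcs := sq_integral_mul_le hRabs hind
  have e1 : ∫ x, |overlap x ^ k| ^ 2 ∂P.prod P = overlapMoment P (2 * k) := by
    simp only [sq_abs, overlapMoment, ← pow_mul, mul_comm k 2]
  have e2 : ∫ x, s.indicator (fun _ => (1 : ℝ)) x ^ 2 ∂P.prod P = (P.prod P).real s := by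
    rw [← integral_indicator_one hs]
    congr 1
    ext x
    by_cases hx : x ∈ s <;> simp [hx]
  rw [e1, e2] at hcs
  have hle : ∫ x, |overlap x ^ k| * s.indicator (fun _ => (1 : ℝ)) x ∂P.prod P ≤
      M * Real.exp (-d / 2) := by
    refine abs_le_of_sq_le_sq' ?_ (by positivity) |>.2
    refine hcs.trans ?_
    rw [mul_pow, ← Real.exp_nat_mul, show ((2 : ℕ) : ℝ) * (-d / 2) = -d by push_cast; ring]
    gcongr
  calc |overlapMoment P k| ≤ ∫ x, |overlap x ^ k| ∂P.prod P := abs_integral_le_integral_abs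
    _ ≤ ∫ x, (q ^ k + |overlap x ^ k| * s.indicator (fun _ => (1 : ℝ)) x) ∂P.prod P := by
        refine integral_mono hRabs.integrable
          ((HasAllMoments.const _).add (hRabs.mul hind)).integrable fun x => ?_
        by_cases hx : x ∈ s
        · simp only [hx, Set.indicator_of_mem, mul_one]
          linarith [pow_nonneg hq k]
        · simp only [hx, not_false_eq_true, Set.indicator_of_notMem, mul_zero, add_zero, abs_pow]
          exact pow_le_pow_left₀ (abs_nonneg _) (not_lt.mp hx) k
    _ ≤ _ := by
        rw [integral_add (integrable_const _) (hRabs.mul hind).integrable]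
        simpa using hle

/-- The moments of the overlap up to order `d + 1` are those of a high quantile, up to a constant
factor. -/
lemma abs_overlapMoment_le_of_isSubWeibull {φ K C C₁ q : ℝ} (hφ : 0 < φ) (hK : 0 < K)
    (hsw : ∀ i, IsSubWeibull φ K (fun x : Fin n → ℝ => x i) P) {d : ℕ} (hd : 1 ≤ d) (hn : 1 ≤ n)
    (hC : 0 < C) (hC₁ : 0 < C₁) (hdC : (d : ℝ) ≤ (n : ℝ) ^ C) (hq : (n : ℝ) ^ (-C₁) ≤ q)
    (htail : (P.prod P).real {x | q < |overlap x|} ≤ Real.exp (-(d * Real.log n ^ 2)))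
    (hnK : (K * 4 ^ (1 / φ)) ^ 2 ≤ n)
    (hlog : 4 * (2 + C₁ + 2 * (C / φ)) + 4 ≤ Real.log n) {k : ℕ} (hk : 1 ≤ k) (hkd : k ≤ d + 1) :
    |overlapMoment P k| ≤ 5 / 4 * q ^ k := by
  have hP := fun i => hasAllMoments_of_isSubWeibull (hsw i)
  have hn0 : (0 : ℝ) < n := by exact_mod_cast hn
  have hn1 : (1 : ℝ) ≤ n := by exact_mod_cast hn
  have hd1 : (1 : ℝ) ≤ d := by exact_mod_cast hd
  have hq0 : 0 < q := (Real.rpow_pos_of_pos hn0 _).trans_le hq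
  -- The exponent collects one `n` from the power mean, one absorbing the sub-Weibull constant, `2 C
  -- / φ` from `B ^ 2`, and `C₁` to trade `n ^ (-C₁)` for `q`.
  set c := 2 + C₁ + 2 * (C / φ) with hc
  have hc0 : 0 < c := by positivity
  set B := K * (2 * k : ℝ) ^ (1 / φ) with hB
  have hB0 : 0 ≤ B := by positivity
  have hmom := overlapMoment_two_mul_le hP hn hk fun i =>
    integral_pow_le_of_isSubWeibull hK.le (hsw i) hk
  have h1 := abs_overlapMoment_le hP hq0.le htail (by positivity) hmom
  have hk4 : (2 * k : ℝ) ≤ 4 * (n : ℝ) ^ C := by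
    have : (k : ℝ) ≤ d + 1 := by exact_mod_cast hkd
    linarith
  have hBle : B ≤ K * 4 ^ (1 / φ) * (n : ℝ) ^ (C / φ) := by
    calc B ≤ K * (4 * (n : ℝ) ^ C) ^ (1 / φ) := by rw [hB]; gcongr
      _ = _ := by
        rw [Real.mul_rpow (by norm_num) (by positivity), ← Real.rpow_mul hn0.le, mul_one_div]
        ring
  have hbase : n * B ^ 2 ≤ (n : ℝ) ^ c * q := by
    calc n * B ^ 2 ≤ n * (K * 4 ^ (1 / φ) * (n : ℝ) ^ (C / φ)) ^ 2 := by gcongr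
      _ = n * ((K * 4 ^ (1 / φ)) ^ 2 * ((n : ℝ) ^ (C / φ)) ^ 2) := by ring
      _ ≤ n * (n * ((n : ℝ) ^ (C / φ)) ^ 2) := by gcongr
      _ = (n : ℝ) ^ c * (n : ℝ) ^ (-C₁) := by
        rw [← Real.rpow_natCast ((n : ℝ) ^ (C / φ)), ← Real.rpow_mul hn0.le,
          ← Real.rpow_add hn0, ← mul_assoc, ← sq, ← Real.rpow_natCast (n : ℝ) 2,
          ← Real.rpow_add hn0]
        congr 1
        rw [hc]
        push_cast
        ring
      _ ≤ _ := by gcongr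
  have hexp : ((n : ℝ) ^ c) ^ k * Real.exp (-(d * Real.log n ^ 2) / 2) ≤ 1 / 4 := by
    have hkd' : (k : ℝ) ≤ 2 * d := by
      have : (k : ℝ) ≤ d + 1 := by exact_mod_cast hkd
      linarith
    rw [Real.rpow_def_of_pos hn0, ← Real.exp_nat_mul, ← Real.exp_add]
    have hL : 0 < Real.log n := by linarith
    -- With `L = log n ≥ 4 c + 4` and `k ≤ 2 d`, the exponent is at most `d L (2 c - L / 2) ≤ -2 d L
    -- ≤ -2`.
    have h2 : k * (Real.log n * c) + -(d * Real.log n ^ 2) / 2 ≤ -2 := by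
      have h3 : (k : ℝ) * (Real.log n * c) ≤ 2 * d * (Real.log n * c) := by gcongr
      have h4 : (d : ℝ) * Real.log n * (2 * c - Real.log n / 2) ≤ d * Real.log n * (-2) := by
        gcongr
        linarith
      have h5 : 1 * 1 ≤ (d : ℝ) * Real.log n := by
        gcongr
        linarith
      nlinarith
    have h6 : Real.exp (-2) ≤ 1 / 4 := by
      rw [show (-2 : ℝ) = -1 + -1 by norm_num, Real.exp_add]
      have h7 : Real.exp (-1) ≤ 1 / 2 := by
        rw [Real.exp_neg, one_div]
        exact inv_anti₀ (by norm_num) (by linarith [Real.add_one_le_exp 1])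
      nlinarith [Real.exp_pos (-1)]
    exact (Real.exp_le_exp.mpr h2).trans h6
  have hlast : (n * B ^ 2) ^ k * Real.exp (-(d * Real.log n ^ 2) / 2) ≤ 1 / 4 * q ^ k := by
    calc _ ≤ ((n : ℝ) ^ c * q) ^ k * Real.exp (-(d * Real.log n ^ 2) / 2) := by gcongr
      _ = (((n : ℝ) ^ c) ^ k * Real.exp (-(d * Real.log n ^ 2) / 2)) * q ^ k := by
        rw [mul_pow]; ring
      _ ≤ _ := by gcongr
  linarith

end GaussianAdditive

/-! ### Asymptotic assembly. -/

namespace GaussianAdditive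

open MeasureTheory ProbabilityTheory Filter Topology

/-- The low-degree correlation is small as long as the signal-to-noise ratio times the quantile
`q(D log² n)` is at most `1 / log n`. -/
lemma eventually_lowDegreeCorr_sq_le {P : ∀ n : ℕ, Measure (Fin n → ℝ)}
    (hP : ∀ n, IsProbabilityMeasure (P n)) {f : ℕ → ℝ → ℝ} {D D' : ℕ → ℕ} {A : ℕ → ℝ} {C : ℝ}
    (hGAM : IsLowOrderCumulantNonneg P f D A C)
    (hD' : ∀ᶠ n : ℕ in atTop, (D n : ℝ) * Real.log n ^ 2 ≤ (D' n : ℝ)) :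
    ∀ᶠ n : ℕ in atTop, 0 < overlapQuantile (P n) (D n * Real.log n ^ 2) ∧ 0 < Real.log n ∧
      ∀ lam : ℝ, 0 ≤ lam →
        lam ≤ 1 / (overlapQuantile (P n) (D n * Real.log n ^ 2) * Real.log n) →
        lowDegreeCorr (P n) (D n) lam ^ 2 ≤ 2 * overlapQuantile (P n) (D' n) := by
  obtain ⟨φ, hφ, K, hK, hsw⟩ := hGAM.subWeibull
  obtain ⟨C₁, hC₁, hqd⟩ := hGAM.quantile_decay
  have hlogT : Tendsto (fun n : ℕ => Real.log n) atTop atTop :=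
    Real.tendsto_log_atTop.comp tendsto_natCast_atTop_atTop
  filter_upwards [hD', hGAM.D_le, hGAM.cumulant_nonneg, hsw, hqd, eventually_ge_atTop 1,
    tendsto_natCast_atTop_atTop.eventually_ge_atTop ((K * 4 ^ (1 / φ)) ^ 2),
    hlogT.eventually_ge_atTop (4 * (2 + C₁ + 2 * (C / φ)) + 4),
    hlogT.eventually_ge_atTop 100] with n hD' hDC hκ hsw hqd hn hnK hlog hlog100
  have := hP n
  set q := overlapQuantile (P n) (D n * Real.log n ^ 2) with hq
  have hn0 : (0 : ℝ) < n := by exact_mod_cast hn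
  have hqC : (n : ℝ) ^ (-C₁) ≤ q := (le_max_right _ _).trans hqd
  have hq0 : 0 < q := (Real.rpow_pos_of_pos hn0 _).trans_le hqC
  have hL : 0 < Real.log n := by linarith
  refine ⟨hq0, hL, fun lam hlam hle => ?_⟩
  have hDpos : (0 : ℝ) < D n := by exact_mod_cast hGAM.D_pos n
  refine (lowDegreeCorr_sq_le_two_mul (fun i => hasAllMoments_of_isSubWeibull (hsw i)) hκ
    (hGAM.D_pos n) hlam hq0.le ?_ fun k hk hkd =>
      abs_overlapMoment_le_of_isSubWeibull hφ hK hsw (hGAM.D_pos n) hn hGAM.C_pos hC₁ hDC hqC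
        (measureReal_overlapQuantile_lt _) hnK hlog hk hkd).trans ?_
  -- `lam * q ≤ 1 / log n ≤ 1 / 100`.
  · rw [le_div_iff₀ (by positivity)] at hle
    have h0 : 0 ≤ lam * q := by positivity
    nlinarith
  · exact mul_le_mul_of_nonneg_left (overlapQuantile_mono (by positivity) hD') (by norm_num)

end GaussianAdditive

theorem theorem2p4
    (P : ∀ n : ℕ, MeasureTheory.Measure (Fin n → ℝ))
    (hP : ∀ n, MeasureTheory.IsProbabilityMeasure (P n))
    (f : ℕ → ℝ → ℝ) (D D' : ℕ → ℕ) (A : ℕ → ℝ) (C : ℝ)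
    (hf : GaussianAdditive.HasRegularOverlapPDF P f D)
    (hGAM : GaussianAdditive.IsLowOrderCumulantNonneg P f D A C)
    (hD'_asymp : Asymptotics.IsEquivalent Filter.atTop
      (fun n : ℕ => (D' n : ℝ)) (fun n : ℕ => (D n : ℝ) * Real.log n ^ 2))
    (hD'_ge : ∀ᶠ n : ℕ in Filter.atTop, (D n : ℝ) * Real.log n ^ 2 ≤ (D' n : ℝ)) :
    (∀ᶠ n : ℕ in Filter.atTop, ∀ u : ℝ, 0 < u →
      0 < u + deriv (GaussianAdditive.annealedFP (f n) u)
        (GaussianAdditive.overlapQuantile (P n) (D n)) →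
      GaussianAdditive.lowDegreeCorr (P n) (D n)
          (1 / A n * (u + deriv (GaussianAdditive.annealedFP (f n) u)
            (GaussianAdditive.overlapQuantile (P n) (D n)))) ^ 2 ≤
        2 * GaussianAdditive.overlapQuantile (P n) (D' n)) ∧
    (∀ lam : ℕ → ℝ, (∀ n, 0 < lam n) → ∀ᶠ n : ℕ in Filter.atTop,
      0 ≤ deriv (GaussianAdditive.annealedFP (f n) (lam n))
        (GaussianAdditive.overlapQuantile (P n) (D n)) →
      GaussianAdditive.lowDegreeCorr (P n) (D n) (1 / A n * lam n) ^ 2 ≤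
        2 * GaussianAdditive.overlapQuantile (P n) (D' n)) := by
  have hcore := GaussianAdditive.eventually_lowDegreeCorr_sq_le hP hGAM hD'_ge
  have hscale {A B x : ℝ} (hA : 0 < A) (hx : x ≤ A / B) : 1 / A * x ≤ 1 / B := by
    calc 1 / A * x ≤ 1 / A * (A / B) := by gcongr
      _ = 1 / B := by field_simp
  refine ⟨?_, fun lam hlam => ?_⟩
  · filter_upwards [hf, hcore, hGAM.quantile_stability] with n hfn hn hstab u _ hpos
    have hA := hGAM.A_pos n
    refine hn.2.2 _ (by positivity) (hscale hA ?_)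
    -- What remains is `-(log f)'` at the quantile, which stability bounds by `A / (q log n)`.
    rw [GaussianAdditive.deriv_annealedFP u hfn.2.1 hfn.2.2]
    linarith
  · filter_upwards [hf, hcore, hGAM.quantile_stability] with n hfn hn hstab hnonneg
    have hA := hGAM.A_pos n
    have hl := hlam n
    refine hn.2.2 _ (by positivity) (hscale hA ?_)
    -- Nonnegativity of the slope says `lam ≤ -(log f)'`, so the same bound applies to `lam`.
    rw [GaussianAdditive.deriv_annealedFP (lam n) hfn.2.1 hfn.2.2] at hnonneg
    linarith
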